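/- **Theorem.** Let $\mathbb{H}:=\{z\in\mathbb{C}:\operatorname{Re} z>0\}$ and let $h:\mathbb{H}\to\mathbb{C}$ be holomorphic. Suppose that $h'(\mathbb{H})$ is contained in a closed Euclidean disk $B\subset\mathbb{C}$ with $0\notin B$. Put $$K:=\max_{w,z\in B}\sqrt{|w/z|},\qquad k:=\frac{K-1}{K+1}.$$ Then $h$ has a $k$-quasiconformal extension to the Riemann sphere $\overline{\mathbb{C}}$ with a fixed point at $\infty$; that is, there is a $k$-quasiconformal homeomorphism $\tilde h:\overline{\mathbb{C}}\to\overline{\mathbb{C}}$ with $\tilde h|_{\mathbb{H}}=h$ and $\tilde h(\infty)=\infty$. Explicitly, let $w_1,w_2\in B$ be the points at which $w\mapsto|w|$ attains its maximum and its minimum on $B$, and let $\omega:=\sqrt{w_1w_2}$ be the square root that lies in $B$. Then $h$ has a finite limit $h(iy):=\lim_{\mathbb{H}\ni z\to iy}h(z)$ at every point $iy$, $y\in\mathbb{R}$, of the imaginary axis, and $\tilde h$ can be chosen so that $$\tilde h(x+iy)=h(iy)+\omega x\qquad\text{for all } y\in\mathbb{R},\ x\le 0 .$$ Here, for $k\in[0,1)$,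 an orientation-preserving homeomorphism $f$ of a domain $G\subset\mathbb{C}$ onto its image is called $k$-quasiconformal if it has distributional derivatives $\partial_z f$ and $\partial_{\bar z}f$ of class $L^1_{\mathrm{loc}}$ in $G$ with $|\partial_{\bar z}f|\le k\,|\partial_z f|$ almost everywhere in $G$; a self-homeomorphism of $\overline{\mathbb{C}}$ is called $k$-quasiconformal if it is so in the local coordinates $z$ and $1/z$. -/

import Mathlib

open MeasureTheory Set Filter Topology
open scoped OnePoint

noncomputable section

namespace QCExt

/-- The right half-plane. -/
def rightHalfPlane : Set ℂ := {z | 0 < z.re}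

/-- The classical Wirtinger derivative `∂φ/∂z` of a real-differentiable function. -/
def dz (φ : ℂ → ℂ) (z : ℂ) : ℂ :=
  (1 / 2) * (fderiv ℝ φ z 1 - Complex.I * fderiv ℝ φ z Complex.I)

/-- The classical Wirtinger derivative `∂φ/∂z̄` of a real-differentiable function. -/
def dzbar (φ : ℂ → ℂ) (z : ℂ) : ℂ :=
  (1 / 2) * (fderiv ℝ φ z 1 + Complex.I * fderiv ℝ φ z Complex.I)

/-- `φ` is a smooth complex-valued test function with compact support in `G`. -/
def IsTestFunction (G : Set ℂ) (φ : ℂ → ℂ) : Prop :=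
  ContDiff ℝ ((⊤ : ℕ∞) : WithTop ℕ∞) φ ∧ HasCompactSupport φ ∧ tsupport φ ⊆ G

/-- On the open set `G` the distributional derivative `∂f/∂z` is the function `g`. -/
def HasDistribDz (G : Set ℂ) (f g : ℂ → ℂ) : Prop :=
  ∀ φ : ℂ → ℂ, IsTestFunction G φ → ∫ z, f z * dz φ z = - ∫ z, g z * φ z

/-- On the open set `G` the distributional derivative `∂f/∂z̄` is the function `g`. -/
def HasDistribDzbar (G : Set ℂ) (f g : ℂ → ℂ) : Prop :=
  ∀ φ : ℂ → ℂ, IsTestFunction G φ → ∫ z, f z * dzbar φ z = - ∫ z, g z * φ z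

/-- The closed curve `γ : [0, 2π] → ℂ` avoids the point `a` and its argument seen from `a`
has a continuous branch with total increase `2πn`, that is, `γ` has winding number `n`
about `a`. -/
def HasWindingNumber (γ : ℝ → ℂ) (a : ℂ) (n : ℤ) : Prop :=
  (∀ t ∈ Icc 0 (2 * Real.pi), γ t ≠ a) ∧
  ∃ θ : ℝ → ℝ, ContinuousOn θ (Icc 0 (2 * Real.pi)) ∧
    (∀ t ∈ Icc 0 (2 * Real.pi),
      γ t - a = (‖γ t - a‖ : ℂ) * Complex.exp ((θ t : ℂ) * Complex.I)) ∧
    θ (2 * Real.pi) - θ 0 = 2 * Real.pi * n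

/-- `f` preserves orientation on `G`: it has local degree `+1` at each point `a` of `G`,
read off as the winding number about `f a` of the image of a circle around `a` bounding a
closed disk in `G` (for a topological embedding `f` all such circles give the same number). -/
def PreservesOrientationOn (G : Set ℂ) (f : ℂ → ℂ) : Prop :=
  ∀ a ∈ G, ∃ r : ℝ, 0 < r ∧ Metric.closedBall a r ⊆ G ∧
    HasWindingNumber (fun t => f (circleMap a r t)) (f a) 1

/-- `f` is a `k`-quasiconformal map of the plane domain `G` onto its image: an
orientation-preserving homeomorphism onto an open set, having distributional derivatives
`∂f/∂z` and `∂f/∂z̄` of class `L¹_loc` on `G` with `|∂f/∂z̄| ≤ k |∂f/∂z|` a.e. on `G`,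
where `0 ≤ k < 1`. -/
structure IsQuasiconformalOn (k : ℝ) (G : Set ℂ) (f : ℂ → ℂ) : Prop where
  k_nonneg : 0 ≤ k
  k_lt_one : k < 1
  isOpen : IsOpen G
  isConnected : IsConnected G
  isOpenEmbedding : IsOpenEmbedding (G.domRestrict f)
  preservesOrientation : PreservesOrientationOn G f
  distrib_deriv : ∃ fz fzbar : ℂ → ℂ,
    LocallyIntegrableOn fz G ∧ LocallyIntegrableOn fzbar G ∧
    HasDistribDz G f fz ∧ HasDistribDzbar G f fzbar ∧
    ∀ᵐ z ∂(volume.restrict G), ‖fzbar z‖ ≤ k * ‖fz z‖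

/-- The inversion `z ↦ 1/z` of the Riemann sphere `ℂ ∪ {∞}`. -/
def sphereInv (p : OnePoint ℂ) : OnePoint ℂ :=
  p.elim ((0 : ℂ) : OnePoint ℂ) (fun z => if z = 0 then ∞ else ((z⁻¹ : ℂ) : OnePoint ℂ))

/-- The coordinate of a finite point of the sphere (with the unused value `0` at `∞`). -/
def finiteCoord (p : OnePoint ℂ) : ℂ := p.elim 0 id

/-- A self-homeomorphism `f` of the Riemann sphere is `k`-quasiconformal if it is so in the
two standard coordinates `z` and `1/z`. With `A` and `B` each equal to the identity or to
`1/z`, the coordinate expression of `f` is `z ↦ B (f (A z))` on the set of all `z ∈ ℂ` at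
which this value is finite. -/
def IsSphereQuasiconformal (k : ℝ) (f : OnePoint ℂ ≃ₜ OnePoint ℂ) : Prop :=
  ∀ A ∈ ({id, sphereInv} : Set (OnePoint ℂ → OnePoint ℂ)),
  ∀ B ∈ ({id, sphereInv} : Set (OnePoint ℂ → OnePoint ℂ)),
    IsQuasiconformalOn k {z : ℂ | B (f (A (z : OnePoint ℂ))) ≠ ∞}
      (fun z => finiteCoord (B (f (A (z : OnePoint ℂ)))))

end QCExt

end

/-! Write `B` as the closed disk about `c` of radius `ρ‖c‖` with `ρ < 1`. By convexity of the
half-plane, the mean value inequality turns the derivative bound into `‖h z - h w - c (z - w)‖ ≤ ρ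
‖c‖ ‖z - w‖`. So `h - c z` is Lipschitz, and `h` extends continuously to a map `H` with the same
estimate on the closed half-plane (`exists_slopesIn_extension`).

Put `t = √(1 - ρ²)` and `ω = c t`, and continue `H` affinely to the left with slope `ω` (`extend`).
In the coordinate `fold t`, which compresses the left half-plane by `t`, this map differs from
multiplication by `c` by a `ρ‖c‖`-Lipschitz error (`norm_extend_sub_le`). Since `ρ < 1`, it is a
bi-Lipschitz homeomorphism, and its difference quotients have a continuous logarithm, which gives
orientation.

On the left, its derivative is `c t` horizontally and `i c γ` vertically, with `‖γ - 1‖ ≤ ρ`. Hence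
the dilatation is `|t - γ| / |t + γ|`, and `t` is the value for which the disk about `1` of radius
`ρ` is the Apollonius disk on which this ratio is at most `k` (`norm_sub_le_of_mem_disk`).

The distributional derivatives are the pointwise ones because all coordinate expressions are locally
Lipschitz; at `∞` this follows from the bi-Lipschitz bounds (`isTameAt_inv_comp_inv_zero`). -/

noncomputable section

namespace QCExt

open scoped NNReal

/-! ### Distributional derivatives of locally Lipschitz maps -/

section Real

variable {f φ : ℂ → ℝ} {C : ℝ≥0}

theorem integrable_lipschitz_mul_fderiv (hf : LipschitzWith C f) (hφ : ContDiff ℝ 1 φ)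
    (hc : HasCompactSupport φ) (v : ℂ) : Integrable fun z => f z * fderiv ℝ φ z v :=
  (hf.continuous.mul ((hφ.continuous_fderiv one_ne_zero).clm_apply
    continuous_const)).integrable_of_hasCompactSupport ((hc.fderiv_apply ℝ v).mul_left)

theorem integrable_fderiv_lipschitz_mul (hf : LipschitzWith C f) (hφ : Continuous φ)
    (hc : HasCompactSupport φ) (v : ℂ) : Integrable fun z => fderiv ℝ f z v * φ z := by
  refine (hφ.integrable_of_hasCompactSupport hc).bdd_mul (c := C * ‖v‖)
    (measurable_fderiv_apply_const ℝ f v).aestronglyMeasurable (ae_of_all _ fun z => ?_)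
  exact ((fderiv ℝ f z).le_opNorm v).trans
    (mul_le_mul_of_nonneg_right (norm_fderiv_le_of_lipschitz ℝ hf) (norm_nonneg v))

/-- Rademacher's theorem identifies the line derivatives of `f` almost everywhere with values of its
Fréchet derivative. -/
theorem integral_lipschitz_mul_fderiv (hf : LipschitzWith C f) (hφ : ContDiff ℝ 1 φ)
    (hc : HasCompactSupport φ) (v : ℂ) :
    ∫ z, f z * fderiv ℝ φ z v = - ∫ z, fderiv ℝ f z v * φ z := by
  obtain ⟨D, hD⟩ := hφ.lipschitzWith_of_hasCompactSupport hc one_ne_zero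
  have key := hf.integral_lineDeriv_mul_eq (μ := volume) hD hc v
  have e1 : ∫ z, lineDeriv ℝ f z v * φ z = ∫ z, fderiv ℝ f z v * φ z := by
    refine integral_congr_ae ?_
    filter_upwards [hf.ae_differentiableAt] with z hz
    simp only [hz.lineDeriv_eq_fderiv]
  have e2 : ∫ z, lineDeriv ℝ φ z (-v) * f z = - ∫ z, f z * fderiv ℝ φ z v := by
    rw [← integral_neg]
    refine integral_congr_ae (ae_of_all _ fun z => ?_)
    simp only [(hφ.differentiable one_ne_zero z).lineDeriv_eq_fderiv, map_neg]
    ring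
  rw [← e1, key, e2, neg_neg]

end Real

theorem fderiv_re_apply {f : ℂ → ℂ} {z : ℂ} (hf : DifferentiableAt ℝ f z) (v : ℂ) :
    fderiv ℝ (fun z => (f z).re) z v = (fderiv ℝ f z v).re := by
  change fderiv ℝ (Complex.reCLM ∘ f) z v = _
  rw [(Complex.reCLM.hasFDerivAt.comp z hf.hasFDerivAt).fderiv]; rfl

theorem fderiv_im_apply {f : ℂ → ℂ} {z : ℂ} (hf : DifferentiableAt ℝ f z) (v : ℂ) :
    fderiv ℝ (fun z => (f z).im) z v = (fderiv ℝ f z v).im := by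
  change fderiv ℝ (Complex.imCLM ∘ f) z v = _
  rw [(Complex.imCLM.hasFDerivAt.comp z hf.hasFDerivAt).fderiv]; rfl

section Cplx

variable {f φ : ℂ → ℂ} {C : ℝ≥0}

theorem integrable_mul_fderiv (hf : Continuous f) (hφ : ContDiff ℝ 1 φ)
    (hc : HasCompactSupport φ) (v : ℂ) : Integrable fun z => f z * fderiv ℝ φ z v :=
  (hf.mul ((hφ.continuous_fderiv one_ne_zero).clm_apply
    continuous_const)).integrable_of_hasCompactSupport ((hc.fderiv_apply ℝ v).mul_left)

theorem integrable_fderiv_mul (hf : LipschitzWith C f) (hφ : Continuous φ)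
    (hc : HasCompactSupport φ) (v : ℂ) : Integrable fun z => fderiv ℝ f z v * φ z := by
  refine (hφ.integrable_of_hasCompactSupport hc).bdd_mul (c := C * ‖v‖)
    (measurable_fderiv_apply_const ℝ f v).aestronglyMeasurable (ae_of_all _ fun z => ?_)
  exact ((fderiv ℝ f z).le_opNorm v).trans
    (mul_le_mul_of_nonneg_right (norm_fderiv_le_of_lipschitz ℝ hf) (norm_nonneg v))

theorem integral_mul_fderiv (hf : LipschitzWith C f) (hφ : ContDiff ℝ 1 φ)
    (hc : HasCompactSupport φ) (v : ℂ) :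
    ∫ z, f z * fderiv ℝ φ z v = - ∫ z, fderiv ℝ f z v * φ z := by
  have hfr : LipschitzWith C fun z => (f z).re := by
    refine LipschitzWith.of_dist_le_mul fun x y => le_trans ?_ (hf.dist_le_mul x y)
    rw [Real.dist_eq, dist_eq_norm, ← Complex.sub_re]
    exact Complex.abs_re_le_norm _
  have hfi : LipschitzWith C fun z => (f z).im := by
    refine LipschitzWith.of_dist_le_mul fun x y => le_trans ?_ (hf.dist_le_mul x y)
    rw [Real.dist_eq, dist_eq_norm, ← Complex.sub_im]
    exact Complex.abs_im_le_norm _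
  have hpr : ContDiff ℝ 1 fun z => (φ z).re := Complex.reCLM.contDiff.comp hφ
  have hpi : ContDiff ℝ 1 fun z => (φ z).im := Complex.imCLM.contDiff.comp hφ
  have cr : HasCompactSupport fun z => (φ z).re := hc.comp_left (g := Complex.re) rfl
  have ci : HasCompactSupport fun z => (φ z).im := hc.comp_left (g := Complex.im) rfl
  have dφ := hφ.differentiable one_ne_zero
  have I1 := integrable_mul_fderiv hf.continuous hφ hc v
  have I2 := integrable_fderiv_mul hf hφ.continuous hc v
  have E1 : ∀ z, (f z * fderiv ℝ φ z v).re = (f z).re * fderiv ℝ (fun z => (φ z).re) z v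
      - (f z).im * fderiv ℝ (fun z => (φ z).im) z v := fun z => by
    rw [fderiv_re_apply (dφ z), fderiv_im_apply (dφ z), Complex.mul_re]
  have E2 : ∀ z, (f z * fderiv ℝ φ z v).im = (f z).re * fderiv ℝ (fun z => (φ z).im) z v
      + (f z).im * fderiv ℝ (fun z => (φ z).re) z v := fun z => by
    rw [fderiv_re_apply (dφ z), fderiv_im_apply (dφ z), Complex.mul_im]
  have E3 : ∀ᵐ z, (fderiv ℝ f z v * φ z).re = fderiv ℝ (fun z => (f z).re) z v * (φ z).re
      - fderiv ℝ (fun z => (f z).im) z v * (φ z).im := by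
    filter_upwards [hf.ae_differentiableAt] with z hz
    rw [fderiv_re_apply hz, fderiv_im_apply hz, Complex.mul_re]
  have E4 : ∀ᵐ z, (fderiv ℝ f z v * φ z).im = fderiv ℝ (fun z => (f z).re) z v * (φ z).im
      + fderiv ℝ (fun z => (f z).im) z v * (φ z).re := by
    filter_upwards [hf.ae_differentiableAt] with z hz
    rw [fderiv_re_apply hz, fderiv_im_apply hz, Complex.mul_im]
  apply Complex.ext
  · have a := Complex.reCLM.integral_comp_comm I1
    have b := Complex.reCLM.integral_comp_comm I2
    simp only [Complex.reCLM_apply] at a b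
    rw [Complex.neg_re, ← a, ← b, integral_congr_ae (ae_of_all _ E1), integral_congr_ae E3,
      integral_sub (integrable_lipschitz_mul_fderiv hfr hpr cr v)
        (integrable_lipschitz_mul_fderiv hfi hpi ci v),
      integral_sub (integrable_fderiv_lipschitz_mul hfr hpr.continuous cr v)
        (integrable_fderiv_lipschitz_mul hfi hpi.continuous ci v),
      integral_lipschitz_mul_fderiv hfr hpr cr, integral_lipschitz_mul_fderiv hfi hpi ci]
    ring
  · have a := Complex.imCLM.integral_comp_comm I1
    have b := Complex.imCLM.integral_comp_comm I2
    simp only [Complex.imCLM_apply] at a b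
    rw [Complex.neg_im, ← a, ← b, integral_congr_ae (ae_of_all _ E2), integral_congr_ae E4,
      integral_add (integrable_lipschitz_mul_fderiv hfr hpi ci v)
        (integrable_lipschitz_mul_fderiv hfi hpr cr v),
      integral_add (integrable_fderiv_lipschitz_mul hfr hpi.continuous ci v)
        (integrable_fderiv_lipschitz_mul hfi hpr.continuous cr v),
      integral_lipschitz_mul_fderiv hfr hpi ci, integral_lipschitz_mul_fderiv hfi hpr cr]
    ring

/-- Integration by parts on an open set for a locally Lipschitz map and a test function. -/
theorem integral_mul_fderiv_of_locallyLipschitzOn {G : Set ℂ} (hG : IsOpen G)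
    (hf : LocallyLipschitzOn G f) (hφ : IsTestFunction G φ) (v : ℂ) :
    Integrable (fun z => f z * fderiv ℝ φ z v) ∧ Integrable (fun z => fderiv ℝ f z v * φ z) ∧
    ∫ z, f z * fderiv ℝ φ z v = - ∫ z, fderiv ℝ f z v * φ z := by
  obtain ⟨hsm, hc, hsub⟩ := hφ
  -- A globally Lipschitz `g` agreeing with `f` on a compact neighbourhood of `tsupport φ` has the
  -- same values and derivatives wherever `φ` or its derivative is nonzero.
  obtain ⟨K, hK, hφK, hKG⟩ := exists_compact_between hc hG hsub
  obtain ⟨C, hC⟩ := (hf.mono hKG).exists_lipschitzOnWith_of_compact hK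
  obtain ⟨g, hg, hfg⟩ := hC.extend_finite_dimension
  have hsm1 : ContDiff ℝ 1 φ := hsm.of_le (by exact_mod_cast le_top)
  have e1 : (fun z => f z * fderiv ℝ φ z v) = fun z => g z * fderiv ℝ φ z v := by
    ext z
    by_cases hz : z ∈ tsupport φ
    · rw [hfg (interior_subset (hφK hz))]
    · have h0 : fderiv ℝ φ z = 0 := by
        by_contra hne
        exact hz (support_fderiv_subset ℝ hne)
      simp [h0]
  have e2 : (fun z => fderiv ℝ f z v * φ z) = fun z => fderiv ℝ g z v * φ z := by
    ext z
    by_cases hz : z ∈ tsupport φ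
    · have : f =ᶠ[𝓝 z] g :=
        hfg.eventuallyEq_of_mem (mem_interior_iff_mem_nhds.1 (hφK hz))
      rw [this.fderiv_eq]
    · simp [image_eq_zero_of_notMem_tsupport hz]
  rw [e1, e2]
  exact ⟨integrable_mul_fderiv hg.continuous hsm1 hc v,
    integrable_fderiv_mul hg hsm1.continuous hc v, integral_mul_fderiv hg hsm1 hc v⟩

theorem hasDistribDz_of_locallyLipschitzOn {G : Set ℂ} (hG : IsOpen G)
    (hf : LocallyLipschitzOn G f) : HasDistribDz G f (dz f) := by
  intro φ hφ
  obtain ⟨a1, a2, a3⟩ := integral_mul_fderiv_of_locallyLipschitzOn hG hf hφ 1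
  obtain ⟨b1, b2, b3⟩ := integral_mul_fderiv_of_locallyLipschitzOn hG hf hφ Complex.I
  have e1 : ∀ z, f z * dz φ z = (1 / 2) * (f z * fderiv ℝ φ z 1) -
      (Complex.I / 2) * (f z * fderiv ℝ φ z Complex.I) := fun z => by rw [dz]; ring
  have e2 : ∀ z, dz f z * φ z = (1 / 2) * (fderiv ℝ f z 1 * φ z) -
      (Complex.I / 2) * (fderiv ℝ f z Complex.I * φ z) := fun z => by rw [dz]; ring
  simp only [e1, e2]
  rw [integral_sub (a1.const_mul _) (b1.const_mul _), integral_sub (a2.const_mul _)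
    (b2.const_mul _)]
  simp only [integral_const_mul]
  rw [a3, b3]; ring

theorem hasDistribDzbar_of_locallyLipschitzOn {G : Set ℂ} (hG : IsOpen G)
    (hf : LocallyLipschitzOn G f) : HasDistribDzbar G f (dzbar f) := by
  intro φ hφ
  obtain ⟨a1, a2, a3⟩ := integral_mul_fderiv_of_locallyLipschitzOn hG hf hφ 1
  obtain ⟨b1, b2, b3⟩ := integral_mul_fderiv_of_locallyLipschitzOn hG hf hφ Complex.I
  have e1 : ∀ z, f z * dzbar φ z = (1 / 2) * (f z * fderiv ℝ φ z 1) +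
      (Complex.I / 2) * (f z * fderiv ℝ φ z Complex.I) := fun z => by rw [dzbar]; ring
  have e2 : ∀ z, dzbar f z * φ z = (1 / 2) * (fderiv ℝ f z 1 * φ z) +
      (Complex.I / 2) * (fderiv ℝ f z Complex.I * φ z) := fun z => by rw [dzbar]; ring
  simp only [e1, e2]
  rw [integral_add (a1.const_mul _) (b1.const_mul _), integral_add (a2.const_mul _)
    (b2.const_mul _)]
  simp only [integral_const_mul]
  rw [a3, b3]; ring

theorem locallyIntegrableOn_fderiv_apply {G : Set ℂ} (hG : IsOpen G)
    (hf : LocallyLipschitzOn G f) (v : ℂ) :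
    LocallyIntegrableOn (fun z => fderiv ℝ f z v) G := by
  rw [locallyIntegrableOn_iff hG.isLocallyClosed]
  intro K hKG hK
  obtain ⟨K', hK', hKK', hKG'⟩ := exists_compact_between hK hG hKG
  obtain ⟨C, hC⟩ := (hf.mono hKG').exists_lipschitzOnWith_of_compact hK'
  refine Measure.integrableOn_of_bounded (M := C * ‖v‖) hK.measure_lt_top.ne
    (measurable_fderiv_apply_const ℝ f v).aestronglyMeasurable ?_
  filter_upwards [ae_restrict_mem hK.measurableSet] with z hz
  exact ((fderiv ℝ f z).le_opNorm v).trans (mul_le_mul_of_nonneg_right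
    (norm_fderiv_le_of_lipschitzOn ℝ (mem_interior_iff_mem_nhds.1 (hKK' hz)) hC) (norm_nonneg v))

theorem locallyIntegrableOn_const_mul {g : ℂ → ℂ} {G : Set ℂ} (hg : LocallyIntegrableOn g G)
    (a : ℂ) : LocallyIntegrableOn (fun z => a * g z) G := fun x hx => by
  obtain ⟨U, hU, h⟩ := hg x hx
  exact ⟨U, hU, h.const_mul a⟩

theorem locallyIntegrableOn_dz {G : Set ℂ} (hG : IsOpen G)
    (hf : LocallyLipschitzOn G f) : LocallyIntegrableOn (dz f) G :=
  locallyIntegrableOn_const_mul ((locallyIntegrableOn_fderiv_apply hG hf 1).sub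
    (locallyIntegrableOn_const_mul (locallyIntegrableOn_fderiv_apply hG hf Complex.I) _)) _

theorem locallyIntegrableOn_dzbar {G : Set ℂ} (hG : IsOpen G)
    (hf : LocallyLipschitzOn G f) : LocallyIntegrableOn (dzbar f) G :=
  locallyIntegrableOn_const_mul ((locallyIntegrableOn_fderiv_apply hG hf 1).add
    (locallyIntegrableOn_const_mul (locallyIntegrableOn_fderiv_apply hG hf Complex.I) _)) _

end Cplx

/-! ### Pointwise conditions and their behaviour under inversion -/

/-- Near `a` the map `f` is Lipschitz, and the quotient `(f z - f a) / (z - a)` has a continuous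
logarithm on a punctured neighbourhood of `a`. -/
structure IsTameAt (f : ℂ → ℂ) (a : ℂ) : Prop where
  lipschitz : ∃ C : ℝ≥0, ∃ U ∈ 𝓝 a, LipschitzOnWith C f U
  logRatio : ∃ U ∈ 𝓝 a, ∃ l : ℂ → ℂ, ContinuousOn l (U \ {a}) ∧
    ∀ z ∈ U \ {a}, f z - f a = (z - a) * Complex.exp (l z)

theorem IsTameAt.congr {f g : ℂ → ℂ} {a : ℂ} (hf : IsTameAt f a) (h : f =ᶠ[𝓝 a] g) :
    IsTameAt g a := by
  obtain ⟨⟨C, U, hU, hC⟩, V, hV, l, hl, hfl⟩ := hf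
  have ha := h.self_of_nhds
  refine ⟨⟨C, U ∩ {z | f z = g z}, inter_mem hU h, ?_⟩, V ∩ {z | f z = g z}, inter_mem hV h, l,
    hl.mono fun z hz => ⟨hz.1.1, hz.2⟩, fun z hz => ?_⟩
  · intro x hx y hy
    rw [← hx.2, ← hy.2]
    exact hC hx.1 hy.1
  · have hz2 : f z = g z := hz.1.2
    rw [← ha, ← hz2]
    exact hfl z ⟨hz.1.1, hz.2⟩

theorem IsTameAt.continuousAt {f : ℂ → ℂ} {a : ℂ} (hf : IsTameAt f a) : ContinuousAt f a := by
  obtain ⟨C, U, hU, hC⟩ := hf.lipschitz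
  exact hC.continuousOn.continuousAt hU

theorem locallyLipschitzOn_of_isTameAt {f : ℂ → ℂ} {G : Set ℂ} (hf : ∀ a ∈ G, IsTameAt f a) :
    LocallyLipschitzOn G f := fun a ha => by
  obtain ⟨C, U, hU, hC⟩ := (hf a ha).lipschitz
  exact ⟨C, U, mem_nhdsWithin_of_mem_nhds hU, hC⟩

/-- Along a small circle the argument of `f - f a` is `t + Im l`. As `l` is single-valued, its
contribution cancels over a full turn and the total increase is `2π`. -/
theorem preservesOrientationOn_of_isTameAt {f : ℂ → ℂ} {G : Set ℂ} (hG : IsOpen G)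
    (hf : ∀ a ∈ G, IsTameAt f a) : PreservesOrientationOn G f := by
  intro a ha
  obtain ⟨U, hU, l, hl, hfl⟩ := (hf a ha).logRatio
  obtain ⟨r, hr, hrs⟩ := Metric.nhds_basis_closedBall.mem_iff.1 (inter_mem hU (hG.mem_nhds ha))
  have hmem : ∀ t, circleMap a r t ∈ U \ {a} := fun t =>
    ⟨(hrs (circleMap_mem_closedBall a hr.le t)).1, circleMap_ne_center hr.ne'⟩
  have hcont : Continuous fun t => l (circleMap a r t) :=
    hl.comp_continuous (continuous_circleMap a r) hmem
  have hne : ∀ t, f (circleMap a r t) - f a ≠ 0 := fun t => by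
    rw [hfl _ (hmem t)]
    exact mul_ne_zero (sub_ne_zero.2 (hmem t).2) (Complex.exp_ne_zero _)
  have hform : ∀ t, f (circleMap a r t) - f a =
      ((r * Real.exp (l (circleMap a r t)).re : ℝ) : ℂ) *
        Complex.exp (((t + (l (circleMap a r t)).im : ℝ) : ℂ) * Complex.I) := fun t => by
    rw [hfl _ (hmem t), circleMap_sub_center]
    conv_lhs => rw [← Complex.re_add_im (l (circleMap a r t))]
    rw [circleMap, zero_add]
    push_cast
    rw [Complex.exp_add, add_mul, Complex.exp_add]
    ring
  refine ⟨r, hr, fun z hz => (hrs hz).2, fun t _ => sub_ne_zero.1 (hne t),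
    fun t => t + (l (circleMap a r t)).im,
    (continuous_id.add (Complex.continuous_im.comp hcont)).continuousOn, fun t _ => ?_, ?_⟩
  · have hn : ‖f (circleMap a r t) - f a‖ = r * Real.exp (l (circleMap a r t)).re := by
      rw [hform t, norm_mul, Complex.norm_exp_ofReal_mul_I, mul_one, Complex.norm_real,
        Real.norm_of_nonneg (by positivity)]
    simp only [hn]
    exact hform t
  · have : circleMap a r (2 * Real.pi) = circleMap a r 0 := by simp [circleMap]
    simp [this]

/-- If `f` is real-differentiable at `a`, its complex dilatation at `a` is at most `k`. -/
def DilatationLE (k : ℝ) (f : ℂ → ℂ) (a : ℂ) : Prop :=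
  DifferentiableAt ℝ f a → ‖dzbar f a‖ ≤ k * ‖dz f a‖

theorem DilatationLE.congr {k : ℝ} {f g : ℂ → ℂ} {a : ℂ} (hf : DilatationLE k f a)
    (h : f =ᶠ[𝓝 a] g) : DilatationLE k g a := by
  intro hd
  have := hf (h.differentiableAt_iff.2 hd)
  rwa [dz, dzbar, h.fderiv_eq] at this

theorem norm_dzbar_le {k : ℝ} {f : ℂ → ℂ} {a : ℂ} (hf : DilatationLE k f a) :
    ‖dzbar f a‖ ≤ k * ‖dz f a‖ := by
  by_cases hd : DifferentiableAt ℝ f a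
  · exact hf hd
  · simp [dz, dzbar, fderiv_zero_of_not_differentiableAt hd]

/-- The dilatation bound is waived at `0`, a null set: in the chart `1/z` this point is `∞`, where
nothing is known about the derivative. -/
theorem isQuasiconformalOn_of_isTameAt {k : ℝ} (h0 : 0 ≤ k) (h1 : k < 1) {G : Set ℂ}
    {f : ℂ → ℂ} (hG : IsOpen G) (hconn : IsConnected G) (hemb : IsOpenEmbedding (G.domRestrict f))
    (hf : ∀ a ∈ G, IsTameAt f a) (hdil : ∀ a ∈ G, a ≠ 0 → DilatationLE k f a) :
    IsQuasiconformalOn k G f := by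
  have hlip := locallyLipschitzOn_of_isTameAt hf
  refine ⟨h0, h1, hG, hconn, hemb, preservesOrientationOn_of_isTameAt hG hf, dz f, dzbar f,
    locallyIntegrableOn_dz hG hlip, locallyIntegrableOn_dzbar hG hlip,
    hasDistribDz_of_locallyLipschitzOn hG hlip, hasDistribDzbar_of_locallyLipschitzOn hG hlip, ?_⟩
  filter_upwards [ae_restrict_mem hG.measurableSet,
    ae_restrict_of_ae (Measure.ae_ne volume (0 : ℂ))] with a ha ha0
  exact norm_dzbar_le (hdil a ha ha0)

/-! ### Inversion in the target and in the source -/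

theorem div_mem_slitPlane_eventually {f : ℂ → ℂ} {a : ℂ} (hf : ContinuousAt f a) (h0 : f a ≠ 0) :
    ∀ᶠ z in 𝓝 a, f a / f z ∈ Complex.slitPlane := by
  have : Tendsto (fun z => f a / f z) (𝓝 a) (𝓝 1) := by
    rw [← div_self h0]
    exact tendsto_const_nhds.div hf h0
  exact this.eventually (Complex.isOpen_slitPlane.mem_nhds Complex.one_mem_slitPlane)

theorem norm_inv_sub_inv_le {x y : ℂ} {ε : ℝ} (hε : 0 < ε) (hx : ε ≤ ‖x‖) (hy : ε ≤ ‖y‖) :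
    ‖x⁻¹ - y⁻¹‖ ≤ (ε ^ 2)⁻¹ * ‖x - y‖ := by
  have hx0 : x ≠ 0 := norm_pos_iff.1 (hε.trans_le hx)
  have hy0 : y ≠ 0 := norm_pos_iff.1 (hε.trans_le hy)
  rw [inv_sub_inv hx0 hy0, norm_div, norm_mul, div_eq_inv_mul, norm_sub_rev y x]
  gcongr
  nlinarith

theorem lipschitzOnWith_inv {ε : ℝ≥0} (hε : 0 < ε) :
    LipschitzOnWith (ε ^ 2)⁻¹ (fun z : ℂ => z⁻¹) {z | ε ≤ ‖z‖} :=
  LipschitzOnWith.of_dist_le_mul fun x hx y hy => by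
    rw [dist_eq_norm, dist_eq_norm]
    simpa using norm_inv_sub_inv_le hε hx hy

theorem exists_lipschitzOnWith_inv {f : ℂ → ℂ} {a : ℂ} (hf : ContinuousAt f a) (h0 : f a ≠ 0) :
    ∃ ε : ℝ≥0, 0 < ε ∧ ∀ᶠ z in 𝓝 a, f z ∈ {w : ℂ | ε ≤ ‖w‖} := by
  have hp : 0 < ‖f a‖ / 2 := by positivity
  refine ⟨⟨‖f a‖ / 2, hp.le⟩, hp, ?_⟩
  filter_upwards [hf.norm.eventually (lt_mem_nhds (half_lt_self (norm_pos_iff.2 h0)))] with z hz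
  exact hz.le

/-- The logarithm comes from `1/f z - 1/f a = (f z - f a) · (-1/f(a)²) · (f a / f z)`, whose last
factor is near `1` and so has a continuous principal logarithm. -/
theorem IsTameAt.inv {f : ℂ → ℂ} {a : ℂ} (hf : IsTameAt f a) (h0 : f a ≠ 0) :
    IsTameAt (fun z => (f z)⁻¹) a := by
  have hcont := hf.continuousAt
  obtain ⟨⟨C, U, hU, hC⟩, V, hV, l, hl, hfl⟩ := hf
  constructor
  · obtain ⟨ε, hε, hev⟩ := exists_lipschitzOnWith_inv hcont h0
    exact ⟨_, _, inter_mem hU hev, (lipschitzOnWith_inv hε).comp (hC.mono inter_subset_left)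
      fun z hz => hz.2⟩
  · refine ⟨V ∩ (U ∩ {z | f z ≠ 0 ∧ f a / f z ∈ Complex.slitPlane}),
      inter_mem hV (inter_mem hU ((hcont.eventually_ne h0).and
        (div_mem_slitPlane_eventually hcont h0))),
      fun z => l z + (Complex.log (-1 / f a ^ 2) + Complex.log (f a / f z)), ?_, ?_⟩
    · refine (hl.mono fun z hz => ⟨hz.1.1, hz.2⟩).add (continuousOn_const.add ?_)
      refine ContinuousOn.clog ?_ fun z hz => hz.1.2.2.2
      exact continuousOn_const.div (hC.continuousOn.mono fun z hz => hz.1.2.1)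
        fun z hz => hz.1.2.2.1
    · intro z hz
      have hz0 : f z ≠ 0 := hz.1.2.2.1
      rw [Complex.exp_add, Complex.exp_add, ← mul_assoc, ← hfl z ⟨hz.1.1, hz.2⟩, Complex.exp_log,
        Complex.exp_log]
      · field_simp; ring
      · exact div_ne_zero h0 hz0
      · exact div_ne_zero (by simp) (pow_ne_zero 2 h0)

theorem IsTameAt.comp_inv {f : ℂ → ℂ} {a : ℂ} (hf : IsTameAt f a⁻¹) (h0 : a ≠ 0) :
    IsTameAt (fun z => f z⁻¹) a := by
  obtain ⟨⟨C, U, hU, hC⟩, V, hV, l, hl, hfl⟩ := hf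
  have hinv : ContinuousAt (fun z : ℂ => z⁻¹) a := continuousAt_inv₀ h0
  constructor
  · obtain ⟨ε, hε, hev⟩ := exists_lipschitzOnWith_inv continuousAt_id h0
    exact ⟨_, _, inter_mem hev (hinv hU), hC.comp ((lipschitzOnWith_inv hε).mono inter_subset_left)
      fun z hz => hz.2⟩
  · refine ⟨(fun z : ℂ => z⁻¹) ⁻¹' V ∩ {z | z ≠ 0 ∧ a / z ∈ Complex.slitPlane},
      inter_mem (hinv hV) ((continuousAt_id.eventually_ne h0).and
        (div_mem_slitPlane_eventually continuousAt_id h0)),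
      fun z => l z⁻¹ + (Complex.log (-1 / a ^ 2) + Complex.log (a / z)), ?_, ?_⟩
    · refine (hl.comp (continuousOn_id.inv₀ fun z hz => hz.1.2.1) fun z hz =>
        ⟨hz.1.1, fun h => hz.2 (inv_injective h)⟩).add (continuousOn_const.add ?_)
      exact ContinuousOn.clog (continuousOn_const.div continuousOn_id fun z hz => hz.1.2.1)
        fun z hz => hz.1.2.2
    · intro z hz
      have hz0 : z ≠ 0 := hz.1.2.1
      rw [hfl z⁻¹ ⟨hz.1.1, fun h => hz.2 (inv_injective h)⟩, Complex.exp_add, Complex.exp_add,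
        Complex.exp_log, Complex.exp_log]
      · field_simp; ring
      · exact div_ne_zero h0 hz0
      · exact div_ne_zero (by simp) (pow_ne_zero 2 h0)

theorem hasFDerivAt_inv_real {a : ℂ} (h0 : a ≠ 0) :
    HasFDerivAt (𝕜 := ℝ) (fun z : ℂ => z⁻¹)
      (((1 : ℂ →L[ℂ] ℂ).smulRight (-(a ^ 2)⁻¹)).restrictScalars ℝ) a :=
  (hasDerivAt_inv h0).hasFDerivAt.restrictScalars ℝ

theorem map_eq_of_real_linear (L : ℂ →L[ℝ] ℂ) (w : ℂ) :
    L w = w.re * L 1 + w.im * L Complex.I := by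
  conv_lhs => rw [← Complex.re_add_im w, ← mul_one (w.re : ℂ), ← Complex.real_smul,
    ← Complex.real_smul, map_add, map_smul, map_smul, Complex.real_smul, Complex.real_smul]

theorem DilatationLE.inv {k : ℝ} {f : ℂ → ℂ} {a : ℂ} (hf : DilatationLE k f a) (h0 : f a ≠ 0) :
    DilatationLE k (fun z => (f z)⁻¹) a := by
  intro hd
  -- Differentiability of `f` is recovered by inverting a second time.
  have hfd : DifferentiableAt ℝ f a := by
    have : DifferentiableAt ℝ (fun z => ((f z)⁻¹)⁻¹) a := hd.inv (inv_ne_zero h0)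
    simpa only [inv_inv] using this
  have hb := hf hfd
  have e : ∀ v, fderiv ℝ (fun z => (f z)⁻¹) a v = -(f a ^ 2)⁻¹ * fderiv ℝ f a v := fun v => by
    have := ((hasFDerivAt_inv_real h0).comp a hfd.hasFDerivAt).fderiv
    change fderiv ℝ ((fun z : ℂ => z⁻¹) ∘ f) a v = _
    rw [this]
    simp [mul_comm]
  have e1 : dz (fun z => (f z)⁻¹) a = -(f a ^ 2)⁻¹ * dz f a := by simp only [dz, e]; ring
  have e2 : dzbar (fun z => (f z)⁻¹) a = -(f a ^ 2)⁻¹ * dzbar f a := by simp only [dzbar, e]; ring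
  rw [e1, e2, norm_mul, norm_mul]
  nlinarith [mul_le_mul_of_nonneg_left hb (norm_nonneg (-(f a ^ 2)⁻¹))]

/-- Inversion is holomorphic with derivative `m = -1/a²`, so `dz` is multiplied by `m` and `dzbar`
by its conjugate; the moduli scale equally. -/
theorem DilatationLE.comp_inv {k : ℝ} {f : ℂ → ℂ} {a : ℂ} (hf : DilatationLE k f a⁻¹)
    (h0 : a ≠ 0) : DilatationLE k (fun z => f z⁻¹) a := by
  intro hd
  have h0' := inv_ne_zero h0
  have hfd : DifferentiableAt ℝ f a⁻¹ := by
    have hd' : DifferentiableAt ℝ (fun z => f z⁻¹) (a⁻¹)⁻¹ := by rwa [inv_inv]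
    have := hd'.comp a⁻¹ (hasFDerivAt_inv_real h0').differentiableAt
    simpa [Function.comp_def] using this
  have hb := hf hfd
  have e : ∀ v, fderiv ℝ (fun z => f z⁻¹) a v = fderiv ℝ f a⁻¹ (-(a ^ 2)⁻¹ * v) := fun v => by
    have := (hfd.hasFDerivAt.comp a (hasFDerivAt_inv_real h0)).fderiv
    change fderiv ℝ (f ∘ (fun z : ℂ => z⁻¹)) a v = _
    rw [this]
    simp [mul_comm]
  set m := -(a ^ 2)⁻¹ with hm
  have hI := map_eq_of_real_linear (fderiv ℝ f a⁻¹) (m * Complex.I)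
  have h1 := map_eq_of_real_linear (fderiv ℝ f a⁻¹) m
  simp only [Complex.mul_re, Complex.mul_im, Complex.I_re, Complex.I_im, mul_zero, mul_one,
    zero_sub, add_zero] at hI
  have e1 : dz (fun z => f z⁻¹) a = m * dz f a⁻¹ := by
    simp only [dz, e]
    rw [mul_one, hI, h1]
    conv_rhs => rw [← Complex.re_add_im m]
    push_cast
    linear_combination ((1 / 2) * (m.im : ℂ) * fderiv ℝ f a⁻¹ Complex.I) * Complex.I_sq
  have e2 : dzbar (fun z => f z⁻¹) a = (starRingEnd ℂ) m * dzbar f a⁻¹ := by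
    simp only [dzbar, e]
    rw [mul_one, hI, h1]
    have : (starRingEnd ℂ) m = m.re - m.im * Complex.I := by
      apply Complex.ext <;> simp
    rw [this]
    push_cast
    linear_combination ((1 / 2) * (m.im : ℂ) * fderiv ℝ f a⁻¹ Complex.I) * Complex.I_sq
  rw [e1, e2, norm_mul, norm_mul, RCLike.norm_conj]
  nlinarith [mul_le_mul_of_nonneg_left hb (norm_nonneg m)]

/-! ### Quasiconformality on the sphere -/

@[simp] theorem sphereInv_infty : sphereInv ∞ = ((0 : ℂ) : OnePoint ℂ) := rfl

@[simp] theorem sphereInv_zero : sphereInv ((0 : ℂ) : OnePoint ℂ) = ∞ := if_pos rfl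

theorem sphereInv_coe {z : ℂ} (hz : z ≠ 0) :
    sphereInv (z : OnePoint ℂ) = ((z⁻¹ : ℂ) : OnePoint ℂ) := if_neg hz

@[simp] theorem finiteCoord_coe (z : ℂ) : finiteCoord (z : OnePoint ℂ) = z := rfl

@[simp] theorem finiteCoord_infty : finiteCoord ∞ = 0 := rfl

theorem coe_finiteCoord {p : OnePoint ℂ} (hp : p ≠ ∞) : (finiteCoord p : OnePoint ℂ) = p := by
  induction p using OnePoint.rec with
  | infty => exact absurd rfl hp
  | coe z => rfl

theorem sphereInv_involutive : Function.Involutive sphereInv := by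
  intro p
  induction p using OnePoint.rec with
  | infty => simp
  | coe z =>
    by_cases hz : z = 0
    · simp [hz]
    · rw [sphereInv_coe hz, sphereInv_coe (inv_ne_zero hz), inv_inv]

theorem continuous_sphereInv : Continuous sphereInv := by
  rw [continuous_iff_continuousAt]
  intro p
  induction p using OnePoint.rec with
  | infty =>
    rw [OnePoint.continuousAt_infty', sphereInv_infty, coclosedCompact_eq_cocompact,
      ← Metric.cobounded_eq_cocompact]
    have : Tendsto (fun z : ℂ => ((z⁻¹ : ℂ) : OnePoint ℂ)) (Bornology.cobounded ℂ)
        (𝓝 ((0 : ℂ) : OnePoint ℂ)) :=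
      (OnePoint.continuous_coe.tendsto 0).comp tendsto_inv₀_cobounded
    refine this.congr' ?_
    filter_upwards [Bornology.eventually_ne_cobounded (0 : ℂ)] with z hz
    exact (sphereInv_coe hz).symm
  | coe z =>
    rw [OnePoint.continuousAt_coe]
    by_cases hz : z = 0
    · subst hz
      rw [continuousAt_iff_punctured_nhds, Function.comp_apply, sphereInv_zero]
      have : Tendsto (fun z : ℂ => ((z⁻¹ : ℂ) : OnePoint ℂ)) (𝓝[≠] 0) (𝓝 ∞) := by
        have h1 : Tendsto ((↑) : ℂ → OnePoint ℂ) (coclosedCompact ℂ) (𝓝 ∞) :=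
          OnePoint.tendsto_coe_infty
        rw [coclosedCompact_eq_cocompact, ← Metric.cobounded_eq_cocompact] at h1
        exact h1.comp tendsto_inv₀_nhdsNE_zero
      refine this.congr' ?_
      filter_upwards [self_mem_nhdsWithin] with w hw
      exact (sphereInv_coe hw).symm
    · have : ContinuousAt (fun z : ℂ => ((z⁻¹ : ℂ) : OnePoint ℂ)) z :=
        OnePoint.continuous_coe.continuousAt.comp (continuousAt_inv₀ hz)
      refine this.congr ?_
      filter_upwards [eventually_ne_nhds hz] with w hw
      exact (sphereInv_coe hw).symm

/-- The inversion `z ↦ 1/z` as a self-homeomorphism of the sphere. -/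
def sphereInvHomeo : OnePoint ℂ ≃ₜ OnePoint ℂ where
  toEquiv := sphereInv_involutive.toPerm
  continuous_toFun := continuous_sphereInv
  continuous_invFun := continuous_sphereInv

/-- Each of the four coordinate expressions has this form for some sphere homeomorphism `S`. Its
domain is the plane or the plane minus one point, hence connected. -/
theorem isQuasiconformalOn_chart {k : ℝ} (h0 : 0 ≤ k) (h1 : k < 1)
    (S : OnePoint ℂ ≃ₜ OnePoint ℂ)
    (ht : ∀ a : ℂ, S (a : OnePoint ℂ) ≠ ∞ →
      IsTameAt (fun z : ℂ => finiteCoord (S (z : OnePoint ℂ))) a)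
    (hd : ∀ a : ℂ, a ≠ 0 → S (a : OnePoint ℂ) ≠ ∞ →
      DilatationLE k (fun z : ℂ => finiteCoord (S (z : OnePoint ℂ))) a) :
    IsQuasiconformalOn k {z : ℂ | S (z : OnePoint ℂ) ≠ ∞}
      (fun z => finiteCoord (S (z : OnePoint ℂ))) := by
  have hG : IsOpen {z : ℂ | S (z : OnePoint ℂ) ≠ ∞} :=
    (isClosed_singleton (x := (∞ : OnePoint ℂ))).isOpen_compl.preimage (S.continuous.comp OnePoint.continuous_coe)
  refine isQuasiconformalOn_of_isTameAt h0 h1 hG ?_ ?_ ht fun a ha ha0 => hd a ha0 ha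
  · obtain hp | ⟨p, hp⟩ : S.symm ∞ = ∞ ∨ ∃ p : ℂ, (p : OnePoint ℂ) = S.symm ∞ := by
      by_cases h : S.symm ∞ = ∞
      · exact Or.inl h
      · exact Or.inr (OnePoint.ne_infty_iff_exists.1 h)
    · have : {z : ℂ | S (z : OnePoint ℂ) ≠ ∞} = univ := by
        refine eq_univ_of_forall fun z hz => ?_
        rw [← S.eq_symm_apply, hp] at hz
        exact OnePoint.coe_ne_infty z hz
      rw [this]
      exact isConnected_univ
    · have : {z : ℂ | S (z : OnePoint ℂ) ≠ ∞} = {p}ᶜ := by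
        ext z
        rw [mem_ofPred_eq, mem_compl_singleton_iff, ne_eq, ← S.eq_symm_apply, ← hp,
          OnePoint.coe_eq_coe]
      rw [this]
      exact isConnected_compl_singleton_of_one_lt_rank (by simp) p
  · refine IsOpenEmbedding.of_comp _ OnePoint.isOpenEmbedding_coe ?_
    have : ((↑) : ℂ → OnePoint ℂ) ∘ {z : ℂ | S (z : OnePoint ℂ) ≠ ∞}.domRestrict
        (fun z => finiteCoord (S (z : OnePoint ℂ))) = S ∘ (↑) ∘ Subtype.val := by
      ext z : 1
      exact coe_finiteCoord z.2
    rw [this]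
    exact S.isOpenEmbedding.comp (OnePoint.isOpenEmbedding_coe.comp hG.isOpenEmbedding_subtypeVal)

/-! ### From a bi-Lipschitz plane map to the sphere -/

section Sphere

variable {k : ℝ} {F : ℂ ≃ₜ ℂ} {L m : ℝ}

/-- Tameness at `∞`. With `p` the zero of `F`, `F (1/z) = (1/z - p) exp (l (1/z))`, so `g z = z ·
exp (-l (1/z)) / (1 - p z)`. This is why `hratio` is required on the whole punctured plane. -/
theorem isTameAt_inv_comp_inv_zero (hm : 0 < m)
    (hL : ∀ x y, ‖F x - F y‖ ≤ L * ‖x - y‖) (hml : ∀ x y, m * ‖x - y‖ ≤ ‖F x - F y‖)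
    (hratio : ∀ w, ∃ l : ℂ → ℂ, ContinuousOn l {w}ᶜ ∧
      ∀ z, z ≠ w → F z - F w = (z - w) * Complex.exp (l z))
    {g : ℂ → ℂ} (hg0 : g 0 = 0) (hg : ∀ z, z ≠ 0 → g z = (F z⁻¹)⁻¹) : IsTameAt g 0 := by
  set p := F.symm 0 with hp
  have hFp : F p = 0 := F.apply_symm_apply 0
  have hL0 : 0 ≤ L := by simpa using (norm_nonneg _).trans (hL 1 0)
  constructor
  · have hU : {z : ℂ | ‖p * z‖ < 1 / 2} ∈ 𝓝 (0 : ℂ) :=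
      (isOpen_lt (by fun_prop) continuous_const).mem_nhds (by simp)
    have hlow : ∀ z ∈ {z : ℂ | ‖p * z‖ < 1 / 2}, z ≠ 0 → m / 2 ≤ ‖z * F z⁻¹‖ := by
      intro z hz hz0
      have h1 := hml z⁻¹ p
      rw [hFp, sub_zero] at h1
      have h2 : ‖z‖ * ‖z⁻¹ - p‖ = ‖1 - p * z‖ := by
        rw [← norm_mul, mul_sub, mul_inv_cancel₀ hz0, mul_comm z]
      have h3 : 1 - ‖p * z‖ ≤ ‖1 - p * z‖ := by simpa using norm_sub_norm_le 1 (p * z)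
      have hz' : ‖p * z‖ < 1 / 2 := hz
      rw [norm_mul]
      nlinarith [mul_le_mul_of_nonneg_left h1 (norm_nonneg z)]
    have hgn : ∀ z ∈ {z : ℂ | ‖p * z‖ < 1 / 2}, ‖g z‖ ≤ 2 / m * ‖z‖ := by
      intro z hz
      by_cases hz0 : z = 0
      · simp [hz0, hg0]
      · have h1 := hlow z hz hz0
        have hF0 : 0 < ‖F z⁻¹‖ := by
          rw [norm_mul] at h1
          exact pos_of_mul_pos_right ((half_pos hm).trans_le h1) (norm_nonneg z)
        rw [hg z hz0, norm_inv, inv_le_iff_one_le_mul₀ hF0, mul_assoc, ← norm_mul]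
        calc (1 : ℝ) = 2 / m * (m / 2) := by field_simp
          _ ≤ _ := by gcongr
    -- The first summand serves two nonzero points, the second the case where one of them is `0`.
    refine ⟨⟨4 * L / m ^ 2 + 2 / m, by positivity⟩, _, hU,
      LipschitzOnWith.of_dist_le_mul fun x hx y hy => ?_⟩
    rw [dist_eq_norm, dist_eq_norm]
    change ‖g x - g y‖ ≤ (4 * L / m ^ 2 + 2 / m) * ‖x - y‖
    rw [add_mul]
    have hA : 0 ≤ 4 * L / m ^ 2 * ‖x - y‖ := by positivity
    have hB : 0 ≤ 2 / m * ‖x - y‖ := by positivity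
    by_cases hx0 : x = 0
    · have := hgn y hy
      rw [hx0, hg0, zero_sub, zero_sub, norm_neg, norm_neg]
      rw [hx0, zero_sub, norm_neg] at hA
      linarith
    by_cases hy0 : y = 0
    · have := hgn x hx
      rw [hy0, hg0, sub_zero, sub_zero]
      rw [hy0, sub_zero] at hA
      linarith
    have hlx := hlow x hx hx0
    have hly := hlow y hy hy0
    have hxF : x * F x⁻¹ ≠ 0 := norm_pos_iff.1 ((half_pos hm).trans_le hlx)
    have hyF : y * F y⁻¹ ≠ 0 := norm_pos_iff.1 ((half_pos hm).trans_le hly)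
    have e : ‖g x - g y‖ = ‖x * y‖ * ‖F y⁻¹ - F x⁻¹‖ / (‖x * F x⁻¹‖ * ‖y * F y⁻¹‖) := by
      have hFx := right_ne_zero_of_mul hxF
      have hFy := right_ne_zero_of_mul hyF
      have hgen : ∀ u v : ℂ, u ≠ 0 → v ≠ 0 →
          u⁻¹ - v⁻¹ = x * y * (v - u) / (x * u * (y * v)) := fun u v hu hv => by field_simp
      rw [hg x hx0, hg y hy0, ← norm_mul, ← norm_mul, ← norm_div, hgen _ _ hFx hFy]
    have h1 : ‖x * y‖ * ‖F y⁻¹ - F x⁻¹‖ ≤ L * ‖x - y‖ := by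
      have h2 : ‖x * y‖ * ‖y⁻¹ - x⁻¹‖ = ‖x - y‖ := by
        rw [← norm_mul]
        congr 1
        field_simp
      nlinarith [mul_le_mul_of_nonneg_left (hL y⁻¹ x⁻¹) (norm_nonneg (x * y))]
    have h3 : ‖g x - g y‖ ≤ 4 * L / m ^ 2 * ‖x - y‖ := by
      rw [e]
      calc _ ≤ L * ‖x - y‖ / (m / 2 * (m / 2)) := by gcongr
        _ = _ := by field_simp; ring
    linarith
  · obtain ⟨l, hl, hfl⟩ := hratio p
    refine ⟨{z | 1 - p * z ∈ Complex.slitPlane}, ?_,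
      fun z => -l z⁻¹ - Complex.log (1 - p * z), ?_, ?_⟩
    · exact (Complex.isOpen_slitPlane.preimage (by fun_prop :
        Continuous fun z : ℂ => 1 - p * z)).mem_nhds (by simp)
    · refine ContinuousOn.sub (hl.comp (continuousOn_id.inv₀ fun z hz => hz.2) ?_).neg
        (ContinuousOn.clog (by fun_prop) fun z hz => hz.1)
      rintro z ⟨hz, hz0⟩ (h : z⁻¹ = p)
      have hz0' : z ≠ 0 := hz0
      refine Complex.slitPlane_ne_zero hz ?_
      rw [← h, inv_mul_cancel₀ hz0', sub_self]
    · rintro z ⟨hz, hz0⟩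
      have hz0' : z ≠ 0 := hz0
      have h1 : 1 - p * z ≠ 0 := Complex.slitPlane_ne_zero hz
      have hzp : z⁻¹ ≠ p := fun h => h1 (by rw [← h, inv_mul_cancel₀ hz0', sub_self])
      have h2 := hfl z⁻¹ hzp
      rw [hFp, sub_zero] at h2
      rw [hg z hz0', hg0, h2, Complex.exp_sub, Complex.exp_neg, Complex.exp_log h1]
      have h3 : z⁻¹ - p = (1 - p * z) / z := by field_simp
      have h4 := Complex.exp_ne_zero (l z⁻¹)
      rw [h3]
      field_simp
      ring

theorem isSphereQuasiconformal_onePointCongr (h0 : 0 ≤ k) (h1 : k < 1) (hm : 0 < m)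
    (hL : ∀ x y, ‖F x - F y‖ ≤ L * ‖x - y‖) (hml : ∀ x y, m * ‖x - y‖ ≤ ‖F x - F y‖)
    (hratio : ∀ w, ∃ l : ℂ → ℂ, ContinuousOn l {w}ᶜ ∧
      ∀ z, z ≠ w → F z - F w = (z - w) * Complex.exp (l z))
    (hdil : ∀ a, DilatationLE k F a) : IsSphereQuasiconformal k F.onePointCongr := by
  have hL0 : 0 ≤ L := by simpa using (norm_nonneg _).trans (hL 1 0)
  have htame : ∀ a, IsTameAt F a := fun a => by
    refine ⟨⟨⟨L, hL0⟩, univ, univ_mem, LipschitzOnWith.of_dist_le_mul fun x _ y _ => ?_⟩, ?_⟩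
    · rw [dist_eq_norm, dist_eq_norm]
      exact hL x y
    · obtain ⟨l, hl, hfl⟩ := hratio a
      exact ⟨univ, univ_mem, l, hl.mono fun z hz => hz.2, fun z hz => hfl z hz.2⟩
  have hcoe : ∀ z : ℂ, F.onePointCongr (z : OnePoint ℂ) = ((F z : ℂ) : OnePoint ℂ) := fun z => rfl
  have hinf : F.onePointCongr ∞ = ∞ := rfl
  -- At `w = 0` both sides are default values: `finiteCoord ∞ = 0 = 0⁻¹`.
  have hinv : ∀ w : ℂ, finiteCoord (sphereInv (w : OnePoint ℂ)) = w⁻¹ := fun w => by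
    by_cases hw : w = 0
    · simp [hw]
    · rw [sphereInv_coe hw, finiteCoord_coe]
  have hinv_ne : ∀ w : ℂ, sphereInv (w : OnePoint ℂ) ≠ ∞ → w ≠ 0 := by
    rintro w hw rfl
    exact hw sphereInv_zero
  have hpre : ∀ a : ℂ, a ≠ 0 → ∀ᶠ z : ℂ in 𝓝 a,
      F.onePointCongr (sphereInv (z : OnePoint ℂ)) = ((F z⁻¹ : ℂ) : OnePoint ℂ) := fun a ha => by
    filter_upwards [eventually_ne_nhds ha] with z hz
    rw [sphereInv_coe hz, hcoe]
  rintro A (rfl | rfl) B (rfl | rfl)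
  · exact isQuasiconformalOn_chart h0 h1 F.onePointCongr (fun a _ => htame a)
      fun a _ _ => hdil a
  · have e : (fun z : ℂ => finiteCoord (sphereInv (F.onePointCongr (z : OnePoint ℂ)))) =
        fun z => (F z)⁻¹ := by
      ext z : 1
      rw [hcoe, hinv]
    refine isQuasiconformalOn_chart h0 h1 (F.onePointCongr.trans sphereInvHomeo)
      (fun a ha => ?_) fun a _ ha => ?_
    · change IsTameAt (fun z : ℂ => finiteCoord (sphereInv (F.onePointCongr (z : OnePoint ℂ)))) a
      rw [e]
      exact (htame a).inv (hinv_ne _ ha)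
    · change DilatationLE k
        (fun z : ℂ => finiteCoord (sphereInv (F.onePointCongr (z : OnePoint ℂ)))) a
      rw [e]
      exact (hdil a).inv (hinv_ne _ ha)
  · have e : ∀ a : ℂ, a ≠ 0 → (fun z => F z⁻¹) =ᶠ[𝓝 a] fun z : ℂ =>
        finiteCoord ((sphereInvHomeo.trans F.onePointCongr) (z : OnePoint ℂ)) := fun a ha => by
      filter_upwards [hpre a ha] with z hz
      exact (congrArg finiteCoord hz).symm
    refine isQuasiconformalOn_chart h0 h1 (sphereInvHomeo.trans F.onePointCongr)
      (fun a ha => ?_) fun a ha _ => ((hdil a⁻¹).comp_inv ha).congr (e a ha)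
    have ha0 : a ≠ 0 := by
      rintro rfl
      exact ha (by
        change F.onePointCongr (sphereInv ((0 : ℂ) : OnePoint ℂ)) = ∞
        rw [sphereInv_zero, hinf])
    exact ((htame a⁻¹).comp_inv ha0).congr (e a ha0)
  · have e : ∀ a : ℂ, a ≠ 0 → (fun z => (F z⁻¹)⁻¹) =ᶠ[𝓝 a] fun z : ℂ =>
        finiteCoord (((sphereInvHomeo.trans F.onePointCongr).trans sphereInvHomeo)
          (z : OnePoint ℂ)) := fun a ha => by
      filter_upwards [hpre a ha] with z hz
      change _ = finiteCoord (sphereInv (F.onePointCongr (sphereInv (z : OnePoint ℂ))))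
      rw [hz, hinv]
    have hne : ∀ a : ℂ, a ≠ 0 → ((sphereInvHomeo.trans F.onePointCongr).trans sphereInvHomeo)
        (a : OnePoint ℂ) ≠ ∞ → F a⁻¹ ≠ 0 := fun a ha h => by
      change sphereInv (F.onePointCongr (sphereInv (a : OnePoint ℂ))) ≠ ∞ at h
      rw [sphereInv_coe ha, hcoe] at h
      exact hinv_ne _ h
    refine isQuasiconformalOn_chart h0 h1
      ((sphereInvHomeo.trans F.onePointCongr).trans sphereInvHomeo)
      (fun a ha => ?_) fun a ha hf =>
        (((hdil a⁻¹).comp_inv ha).inv (f := fun z => F z⁻¹) (hne a ha hf)).congr (e a ha)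
    by_cases ha0 : a = 0
    · rw [ha0]
      refine isTameAt_inv_comp_inv_zero hm hL hml hratio ?_ fun z hz => ((e z hz).self_of_nhds).symm
      change finiteCoord (sphereInv (F.onePointCongr (sphereInv ((0 : ℂ) : OnePoint ℂ)))) = 0
      rw [sphereInv_zero, hinf, sphereInv_infty, finiteCoord_coe]
    · exact (((htame a⁻¹).comp_inv ha0).inv (f := fun z => F z⁻¹) (hne a ha0 ha)).congr (e a ha0)

end Sphere

/-! ### The extension of a map of the closed right half-plane -/

/-- The map `x + iy ↦ max x 0 + t min x 0 + iy`. -/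
def fold (t : ℝ) (z : ℂ) : ℂ := ⟨max z.re 0 + t * min z.re 0, z.im⟩

/-- The map `x + iy ↦ H (max x 0 + iy) + c t min x 0`. -/
def extend (H : ℂ → ℂ) (c : ℂ) (t : ℝ) (z : ℂ) : ℂ := H (fold 0 z) + c * t * (min z.re 0 : ℝ)

theorem fold_zero_re_nonneg (z : ℂ) : 0 ≤ (fold 0 z).re := by simp [fold]

/-- The increments `p`, `n` of the positive and negative parts of the real coordinate have the same
sign because both parts are monotone. With `0 ≤ p * n`, all estimates on `fold` become quadratic
inequalities. -/
theorem fold_sub_fold (z w : ℂ) : ∃ p n : ℝ, 0 ≤ p * n ∧ z.re - w.re = p + n ∧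
    min z.re 0 - min w.re 0 = n ∧
    ∀ s : ℝ, fold s z - fold s w = ⟨p + s * n, z.im - w.im⟩ := by
  refine ⟨max z.re 0 - max w.re 0, min z.re 0 - min w.re 0, ?_, ?_, rfl, fun s => ?_⟩
  · rcases le_total z.re w.re with h | h
    · exact mul_nonneg_of_nonpos_of_nonpos (sub_nonpos.2 (max_le_max_right 0 h))
        (sub_nonpos.2 (min_le_min_right 0 h))
    · exact mul_nonneg (sub_nonneg.2 (max_le_max_right 0 h))
        (sub_nonneg.2 (min_le_min_right 0 h))
  · linarith [max_add_min z.re 0, max_add_min w.re 0]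
  · apply Complex.ext <;> simp [fold]
    ring

theorem norm_le_norm_of_re_im {z w : ℂ} (h : z.re ^ 2 + z.im ^ 2 ≤ w.re ^ 2 + w.im ^ 2) :
    ‖z‖ ≤ ‖w‖ := by
  rw [← sq_le_sq₀ (norm_nonneg _) (norm_nonneg _), Complex.sq_norm, Complex.sq_norm,
    Complex.normSq_apply, Complex.normSq_apply]
  linarith

section Fold

variable {t : ℝ}

theorem norm_fold_zero_sub_le (ht0 : 0 < t) (z w : ℂ) :
    ‖fold 0 z - fold 0 w‖ ≤ ‖fold t z - fold t w‖ := by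
  obtain ⟨p, n, hpn, -, -, h⟩ := fold_sub_fold z w
  rw [h, h]
  refine norm_le_norm_of_re_im ?_
  simp only
  nlinarith [mul_nonneg ht0.le hpn, sq_nonneg (t * n)]

theorem norm_fold_sub_le (ht0 : 0 < t) (ht1 : t ≤ 1) (z w : ℂ) :
    ‖fold t z - fold t w‖ ≤ ‖z - w‖ := by
  obtain ⟨p, n, hpn, hre, -, h⟩ := fold_sub_fold z w
  rw [h]
  refine norm_le_norm_of_re_im ?_
  simp only [Complex.sub_re, Complex.sub_im, hre]
  nlinarith [mul_nonneg (sub_nonneg.2 ht1) hpn, mul_nonneg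
    (mul_nonneg (sub_nonneg.2 ht1) (by linarith : 0 ≤ 1 + t)) (sq_nonneg n)]

theorem le_norm_fold_sub (ht0 : 0 < t) (ht1 : t ≤ 1) (z w : ℂ) :
    t * ‖z - w‖ ≤ ‖fold t z - fold t w‖ := by
  obtain ⟨p, n, hpn, hre, -, h⟩ := fold_sub_fold z w
  have e : t * ‖z - w‖ = ‖(t : ℂ) * (z - w)‖ := by
    rw [norm_mul, Complex.norm_real, Real.norm_of_nonneg ht0.le]
  rw [h, e]
  refine norm_le_norm_of_re_im ?_
  simp only [Complex.re_ofReal_mul, Complex.im_ofReal_mul, Complex.sub_re, Complex.sub_im, hre]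
  have h1 : 0 ≤ 1 - t ^ 2 := by nlinarith
  nlinarith [mul_nonneg (mul_nonneg ht0.le (sub_nonneg.2 ht1)) hpn, mul_nonneg h1 (sq_nonneg p),
    mul_nonneg h1 (sq_nonneg (z.im - w.im))]

theorem fold_sub_div_re_pos (ht0 : 0 < t) {z w : ℂ} (hzw : z ≠ w) :
    0 < ((fold t z - fold t w) / (z - w)).re := by
  obtain ⟨p, n, hpn, hre, -, h⟩ := fold_sub_fold z w
  have hN : 0 < Complex.normSq (z - w) := Complex.normSq_pos.2 (sub_ne_zero.2 hzw)
  rw [h, Complex.div_re, ← add_div]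
  refine div_pos ?_ hN
  rw [Complex.normSq_apply] at hN
  simp only [Complex.sub_re, Complex.sub_im, hre] at hN ⊢
  by_cases h0 : z.im - w.im = 0
  · rw [h0] at hN ⊢
    by_cases hp : p = 0
    · rw [hp] at hN ⊢
      nlinarith
    · nlinarith [mul_nonneg ht0.le hpn, pow_pos ht0 1, sq_nonneg n, mul_nonneg ht0.le (sq_nonneg n),
        sq_pos_of_ne_zero hp]
  · nlinarith [mul_nonneg ht0.le hpn, mul_nonneg ht0.le (sq_nonneg n), sq_nonneg p,
      sq_pos_of_ne_zero h0]

end Fold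

theorem continuous_fold (t : ℝ) : Continuous (fold t) := by
  have : fold t = fun z : ℂ => ((max z.re 0 + t * min z.re 0 : ℝ) : ℂ) + z.im * Complex.I := by
    ext z
    apply Complex.ext <;> simp [fold]
  rw [this]
  fun_prop

theorem fold_fold {s t : ℝ} (ht0 : 0 < t) (hst : s * t = 1) (z : ℂ) : fold s (fold t z) = z := by
  rcases le_total z.re 0 with h | h
  · have : t * z.re ≤ 0 := mul_nonpos_of_nonneg_of_nonpos ht0.le h
    apply Complex.ext
    · simp only [fold, max_eq_right h, min_eq_left h, zero_add, max_eq_right this,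
        min_eq_left this, ← mul_assoc, hst, one_mul]
    · rfl
  · apply Complex.ext <;> simp [fold, h]

/-- The homeomorphism `x + iy ↦ max x 0 + t min x 0 + iy` of the plane, for `t > 0`. -/
def foldHomeo {t : ℝ} (ht0 : 0 < t) : ℂ ≃ₜ ℂ where
  toFun := fold t
  invFun := fold t⁻¹
  left_inv := fold_fold ht0 (inv_mul_cancel₀ ht0.ne')
  right_inv := fold_fold (inv_pos.2 ht0) (mul_inv_cancel₀ ht0.ne')
  continuous_toFun := continuous_fold t
  continuous_invFun := continuous_fold t⁻¹

/-- The difference quotients of `H` on the closed right half-plane lie in the closed disk about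
`c` of radius `ρ ‖c‖`. -/
def SlopesIn (H : ℂ → ℂ) (c : ℂ) (ρ : ℝ) : Prop :=
  ∀ z w : ℂ, 0 ≤ z.re → 0 ≤ w.re → ‖H z - H w - c * (z - w)‖ ≤ ρ * ‖c‖ * ‖z - w‖

/-! ### Metric and topological properties of the extension -/

section Extend

variable {H : ℂ → ℂ} {c : ℂ} {ρ t : ℝ}

/-- The central estimate: the terms `c t min x 0` cancel, leaving the slope bound for `H` at the
points projected to the closed right half-plane. -/
theorem norm_extend_sub_le (hH : SlopesIn H c ρ) (hρ0 : 0 ≤ ρ) (ht0 : 0 < t) (z w : ℂ) :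
    ‖extend H c t z - extend H c t w - c * (fold t z - fold t w)‖ ≤
      ρ * ‖c‖ * ‖fold t z - fold t w‖ := by
  have e : extend H c t z - extend H c t w - c * (fold t z - fold t w) =
      H (fold 0 z) - H (fold 0 w) - c * (fold 0 z - fold 0 w) := by
    obtain ⟨p, n, -, -, hn, h⟩ := fold_sub_fold z w
    have : fold t z - fold t w = (fold 0 z - fold 0 w) + t * n := by
      rw [h, h]
      apply Complex.ext <;> simp
    rw [this, extend, extend, ← hn]
    push_cast
    ring
  rw [e]
  exact (hH _ _ (fold_zero_re_nonneg z) (fold_zero_re_nonneg w)).trans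
    (mul_le_mul_of_nonneg_left (norm_fold_zero_sub_le ht0 z w) (by positivity))

theorem norm_extend_sub_le_mul (hH : SlopesIn H c ρ) (hρ0 : 0 ≤ ρ) (ht0 : 0 < t) (ht1 : t ≤ 1)
    (z w : ℂ) : ‖extend H c t z - extend H c t w‖ ≤ (1 + ρ) * ‖c‖ * ‖z - w‖ := by
  have h1 := norm_extend_sub_le hH hρ0 ht0 z w
  have h2 := norm_sub_norm_le (extend H c t z - extend H c t w) (c * (fold t z - fold t w))
  have h3 := norm_fold_sub_le ht0 ht1 z w
  rw [norm_mul] at h2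
  nlinarith [mul_le_mul_of_nonneg_left h3 (mul_nonneg (by linarith : 0 ≤ 1 + ρ) (norm_nonneg c))]

theorem le_norm_extend_sub (hH : SlopesIn H c ρ) (hρ0 : 0 ≤ ρ) (hρ1 : ρ < 1) (ht0 : 0 < t)
    (ht1 : t ≤ 1) (z w : ℂ) :
    (1 - ρ) * ‖c‖ * t * ‖z - w‖ ≤ ‖extend H c t z - extend H c t w‖ := by
  have h1 := norm_extend_sub_le hH hρ0 ht0 z w
  have h2 := norm_sub_norm_le (c * (fold t z - fold t w)) (extend H c t z - extend H c t w)
  have h3 := le_norm_fold_sub ht0 ht1 z w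
  rw [norm_mul, norm_sub_rev (c * _)] at h2
  nlinarith [mul_le_mul_of_nonneg_left h3 (mul_nonneg (sub_nonneg.2 hρ1.le) (norm_nonneg c))]

theorem continuous_extend (hH : SlopesIn H c ρ) (hρ0 : 0 ≤ ρ) (ht0 : 0 < t) (ht1 : t ≤ 1) :
    Continuous (extend H c t) :=
  (LipschitzWith.of_dist_le_mul (K := ⟨(1 + ρ) * ‖c‖, by positivity⟩) fun z w => by
    rw [dist_eq_norm, dist_eq_norm]
    exact norm_extend_sub_le_mul hH hρ0 ht0 ht1 z w).continuous

theorem re_pos_of_norm_sub_one_lt {q : ℂ} (hq : ‖q - 1‖ < 1) : 0 < q.re := by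
  have := (abs_lt.1 ((Complex.abs_re_le_norm (q - 1)).trans_lt hq)).1
  rw [Complex.sub_re, Complex.one_re] at this
  linarith

/-- The difference quotient factors as `c`, a quotient of `fold t` and a quotient within `ρ < 1` of
`1`. The last two have positive real part, so principal logarithms are continuous there. -/
theorem exists_log_extend_sub_div (hH : SlopesIn H c ρ) (hc : c ≠ 0) (hρ0 : 0 ≤ ρ) (hρ1 : ρ < 1)
    (ht0 : 0 < t) (ht1 : t ≤ 1) (w : ℂ) :
    ∃ l : ℂ → ℂ, ContinuousOn l {w}ᶜ ∧
      ∀ z, z ≠ w → extend H c t z - extend H c t w = (z - w) * Complex.exp (l z) := by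
  have hcont := continuous_extend hH hρ0 ht0 ht1
  have hfold : ∀ z, z ≠ w → c * (fold t z - fold t w) ≠ 0 := fun z hz =>
    mul_ne_zero hc (sub_ne_zero.2 fun h => hz ((foldHomeo ht0).injective h))
  have hslit1 : ∀ z, z ≠ w → (extend H c t z - extend H c t w) / (c * (fold t z - fold t w)) ∈
      Complex.slitPlane := fun z hz => by
    refine Or.inl (re_pos_of_norm_sub_one_lt ?_)
    rw [div_sub_one (hfold z hz), norm_div, div_lt_one (norm_pos_iff.2 (hfold z hz))]
    refine (norm_extend_sub_le hH hρ0 ht0 z w).trans_lt ?_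
    rw [mul_assoc, ← norm_mul]
    exact mul_lt_of_lt_one_left (norm_pos_iff.2 (hfold z hz)) hρ1
  have hslit2 : ∀ z, z ≠ w → (fold t z - fold t w) / (z - w) ∈ Complex.slitPlane := fun z hz =>
    Or.inl (fold_sub_div_re_pos ht0 hz)
  refine ⟨fun z => Complex.log c + (Complex.log ((fold t z - fold t w) / (z - w)) +
    Complex.log ((extend H c t z - extend H c t w) / (c * (fold t z - fold t w)))), ?_, ?_⟩
  · refine continuousOn_const.add (ContinuousOn.add (ContinuousOn.clog (ContinuousOn.div
      ((continuous_fold t).sub continuous_const).continuousOn (by fun_prop)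
      fun z hz => sub_ne_zero.2 hz) hslit2) (ContinuousOn.clog (ContinuousOn.div
      (hcont.sub continuous_const).continuousOn
      (continuous_const.mul ((continuous_fold t).sub continuous_const)).continuousOn hfold) hslit1))
  · intro z hz
    have h1 := sub_ne_zero.2 hz
    have h2 := hfold z hz
    rw [Complex.exp_add, Complex.exp_add, Complex.exp_log hc,
      Complex.exp_log (Complex.slitPlane_ne_zero (hslit1 z hz)),
      Complex.exp_log (Complex.slitPlane_ne_zero (hslit2 z hz))]
    have h3 := right_ne_zero_of_mul h2
    field_simp

/-- After undoing `fold t` and dividing by `c`, the map is the identity plus a `ρ`-Lipschitz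
perturbation with `ρ < 1`, hence a homeomorphism of the plane. -/
theorem exists_homeo_extend (hH : SlopesIn H c ρ) (hc : c ≠ 0) (hρ0 : 0 ≤ ρ) (hρ1 : ρ < 1)
    (ht0 : 0 < t) : ∃ F : ℂ ≃ₜ ℂ, ∀ z, F z = extend H c t z := by
  set T := foldHomeo ht0
  have hA : ApproximatesLinearOn (fun z => c⁻¹ * extend H c t (T.symm z))
      ((ContinuousLinearEquiv.refl ℂ ℂ : ℂ ≃L[ℂ] ℂ) : ℂ →L[ℂ] ℂ) univ ⟨ρ, hρ0⟩ := by
    intro z _ w _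
    have h := norm_extend_sub_le hH hρ0 ht0 (T.symm z) (T.symm w)
    have hz : fold t (T.symm z) = z := T.apply_symm_apply z
    have hw : fold t (T.symm w) = w := T.apply_symm_apply w
    rw [hz, hw] at h
    have e : c⁻¹ * extend H c t (T.symm z) - c⁻¹ * extend H c t (T.symm w) - (z - w) =
        c⁻¹ * (extend H c t (T.symm z) - extend H c t (T.symm w) - c * (z - w)) := by
      field_simp
    change ‖c⁻¹ * extend H c t (T.symm z) - c⁻¹ * extend H c t (T.symm w) - (z - w)‖ ≤
      ρ * ‖z - w‖
    rw [e, norm_mul, norm_inv, inv_mul_le_iff₀ (norm_pos_iff.2 hc)]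
    linarith
  have hlt : (⟨ρ, hρ0⟩ : ℝ≥0) <
      ‖((ContinuousLinearEquiv.refl ℂ ℂ : ℂ ≃L[ℂ] ℂ).symm : ℂ →L[ℂ] ℂ)‖₊⁻¹ := by
    have : ‖((ContinuousLinearEquiv.refl ℂ ℂ : ℂ ≃L[ℂ] ℂ).symm : ℂ →L[ℂ] ℂ)‖₊ = 1 :=
      NNReal.eq (ContinuousLinearMap.norm_id (𝕜 := ℂ) (E := ℂ))
    rw [this, inv_one]
    exact hρ1
  refine ⟨(T.trans (hA.toHomeomorph _ (Or.inr hlt))).trans (Homeomorph.mulLeft₀ c hc),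
    fun z => ?_⟩
  change c * (c⁻¹ * extend H c t (T.symm (T z))) = _
  rw [T.symm_apply_apply, mul_inv_cancel_left₀ hc]

end Extend

/-! ### The dilatation -/

section Dilatation

variable {ρ : ℝ}

theorem one_le_sqrt_div (hρ0 : 0 ≤ ρ) (hρ1 : ρ < 1) : 1 ≤ √((1 + ρ) / (1 - ρ)) := by
  rw [Real.one_le_sqrt, one_le_div (by linarith)]
  linarith

/-- The points with `|t - γ| ≤ k |t + γ|` form the disk with diameter from `t / K` to `t K`; for `t
= √(1 - ρ²)` these endpoints are `1 - ρ` and `1 + ρ`. -/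
theorem norm_sub_le_of_mem_disk (hρ0 : 0 ≤ ρ) (hρ1 : ρ < 1) {γ : ℂ} (hγ : ‖γ - 1‖ ≤ ρ) :
    ‖(√(1 - ρ ^ 2) : ℂ) - γ‖ ≤
      (√((1 + ρ) / (1 - ρ)) - 1) / (√((1 + ρ) / (1 - ρ)) + 1) * ‖(√(1 - ρ ^ 2) : ℂ) + γ‖ := by
  have hK1 := one_le_sqrt_div hρ0 hρ1
  have hKsq : √((1 + ρ) / (1 - ρ)) ^ 2 * (1 - ρ) = 1 + ρ := by
    rw [Real.sq_sqrt (div_nonneg (by linarith) (by linarith)), div_mul_cancel₀]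
    linarith
  -- Expressing `t` through `K` leaves a single square root, with `K² (1 - ρ) = 1 + ρ`.
  have hKt : √(1 - ρ ^ 2) = √((1 + ρ) / (1 - ρ)) * (1 - ρ) := by
    refine (Real.sqrt_eq_iff_mul_self_eq (by nlinarith) (by nlinarith)).2 ?_
    linear_combination (-(1 - ρ)) * hKsq
  rw [hKt]
  set K := √((1 + ρ) / (1 - ρ))
  rw [div_mul_eq_mul_div, le_div_iff₀ (by linarith), mul_comm]
  have h1 : (γ.re - 1) ^ 2 + γ.im ^ 2 ≤ ρ ^ 2 := by
    have := pow_le_pow_left₀ (norm_nonneg _) hγ 2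
    rw [Complex.sq_norm, Complex.normSq_apply] at this
    simp only [Complex.sub_re, Complex.sub_im, Complex.one_re, Complex.one_im] at this
    linarith
  rw [← Real.norm_of_nonneg (by linarith : 0 ≤ K + 1), ← Real.norm_of_nonneg
    (by linarith : 0 ≤ K - 1), ← Complex.norm_real, ← Complex.norm_real, ← norm_mul, ← norm_mul]
  refine norm_le_norm_of_re_im ?_
  simp only [Complex.re_ofReal_mul, Complex.im_ofReal_mul, Complex.sub_re, Complex.sub_im,
    Complex.add_re, Complex.add_im, Complex.ofReal_re, Complex.ofReal_im]
  have hK0 : 0 ≤ K := by linarith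
  have key : 0 ≤ 4 * K * (ρ ^ 2 - ((γ.re - 1) ^ 2 + γ.im ^ 2)) :=
    mul_nonneg (by linarith) (sub_nonneg.2 h1)
  have e : ((K - 1) * (K * (1 - ρ) + γ.re)) ^ 2 + ((K - 1) * (0 + γ.im)) ^ 2 -
      (((K + 1) * (K * (1 - ρ) - γ.re)) ^ 2 + ((K + 1) * (0 - γ.im)) ^ 2) =
      4 * K * (ρ ^ 2 - ((γ.re - 1) ^ 2 + γ.im ^ 2)) := by
    linear_combination (4 * K * γ.re - 4 * K * (1 - ρ)) * hKsq
  linarith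

theorem dilatationLE_extend {H : ℂ → ℂ} {c : ℂ} (hρ0 : 0 ≤ ρ) (hρ1 : ρ < 1) (hH : SlopesIn H c ρ) (hc : c ≠ 0)
    (hd : DifferentiableOn ℂ H rightHalfPlane) (a : ℂ) :
    DilatationLE ((√((1 + ρ) / (1 - ρ)) - 1) / (√((1 + ρ) / (1 - ρ)) + 1))
      (extend H c √(1 - ρ ^ 2)) a := by
  have hK1 := one_le_sqrt_div hρ0 hρ1
  set t := √(1 - ρ ^ 2) with ht
  rcases lt_or_ge 0 a.re with ha | ha
  · have hopen : IsOpen rightHalfPlane := isOpen_lt continuous_const Complex.continuous_re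
    have hnhds : rightHalfPlane ∈ 𝓝 a := hopen.mem_nhds ha
    have e : H =ᶠ[𝓝 a] extend H c t := by
      filter_upwards [hnhds] with z hz
      have hz' : 0 ≤ z.re := le_of_lt hz
      have : fold 0 z = z := by apply Complex.ext <;> simp [fold, hz']
      simp [extend, this, hz']
    refine DilatationLE.congr (fun _ => ?_) e
    have hHd : DifferentiableAt ℂ H a := hd.differentiableAt hnhds
    have h1 : fderiv ℝ H a Complex.I = Complex.I * fderiv ℝ H a 1 := by
      rw [hHd.fderiv_restrictScalars ℝ]
      simp
    have h2 : dzbar H a = 0 := by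
      rw [dzbar, h1, ← mul_assoc, Complex.I_mul_I]
      ring
    rw [h2, norm_zero]
    exact mul_nonneg (div_nonneg (by linarith) (by linarith)) (norm_nonneg _)
  · intro hda
    set L := fderiv ℝ (extend H c t) a with hL
    have hpath : ∀ v : ℂ, HasDerivAt (fun s : ℝ => extend H c t (a + s * v)) (L v) 0 := by
      intro v
      have h1 : HasDerivAt (fun s : ℝ => a + s * v) v 0 := by
        simpa using ((Complex.ofRealCLM.hasDerivAt (x := (0 : ℝ))).mul_const v).const_add a
      have h2 : HasFDerivAt (extend H c t) L (a + ((0 : ℝ) : ℂ) * v) := by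
        simpa using hda.hasFDerivAt
      exact h2.comp_hasDerivAt 0 h1
    have hfold : ∀ z : ℂ, z.re ≤ 0 → extend H c t z = H ⟨0, z.im⟩ + c * t * z.re := by
      intro z hz
      have : fold 0 z = ⟨0, z.im⟩ := by apply Complex.ext <;> simp [fold, hz]
      rw [extend, this, min_eq_left hz]
    have hL1 : L 1 = c * t := by
      -- The derivative from the left determines `L 1`, so points of the imaginary axis are covered
      -- as well.
      have h1 := (hpath 1).hasDerivWithinAt (s := Iic 0)
      have h2 : HasDerivWithinAt (fun s : ℝ => extend H c t (a + s * 1)) (c * t) (Iic 0) 0 := by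
        have h3 : HasDerivAt (fun s : ℝ => H ⟨0, a.im⟩ + c * t * (a.re + s)) (c * t) 0 := by
          simpa using (((Complex.ofRealCLM.hasDerivAt (x := (0 : ℝ))).const_add
            (a.re : ℂ)).const_mul (c * t)).const_add (H ⟨0, a.im⟩)
        have h4 : ∀ s ∈ Iic (0 : ℝ), extend H c t (a + s * 1) =
            H ⟨0, a.im⟩ + c * t * (a.re + s) := fun s hs => by
          have hs' : s ≤ 0 := hs
          rw [hfold _ (by simp; linarith)]
          simp
        exact h3.hasDerivWithinAt.congr h4 (h4 0 self_mem_Iic)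
      exact (uniqueDiffOn_Iic 0 0 self_mem_Iic).eq_deriv _ h1 h2
    -- Vertical difference quotients are those of `H` on the imaginary axis, where only the slope
    -- bound is available.
    have hLI : ‖L Complex.I - c * Complex.I‖ ≤ ρ * ‖c‖ := by
      have h1 : HasDerivAt (fun s : ℝ => extend H c t (a + s * Complex.I) - s * (c * Complex.I))
          (L Complex.I - c * Complex.I) 0 := by
        refine (hpath Complex.I).sub ?_
        simpa using (Complex.ofRealCLM.hasDerivAt (x := (0 : ℝ))).mul_const (c * Complex.I)
      refine h1.le_of_lip' (by positivity) (Eventually.of_forall fun s => ?_)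
      have h2 := hH ⟨0, a.im + s⟩ ⟨0, a.im⟩ le_rfl le_rfl
      have e1 : (⟨0, a.im + s⟩ : ℂ) - ⟨0, a.im⟩ = s * Complex.I := by
        apply Complex.ext <;> simp
      rw [e1] at h2
      rw [hfold _ (by simpa using ha), hfold _ (by simpa using ha)]
      have e2 : ‖(s : ℂ) * Complex.I‖ = ‖s - 0‖ := by simp
      rw [e2] at h2
      refine le_trans (le_of_eq ?_) h2
      congr 1
      simp
      ring
    set γ := -Complex.I * L Complex.I / c with hγ
    have hLI' : L Complex.I = Complex.I * (c * γ) := by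
      rw [hγ, mul_div_cancel₀ _ hc]
      linear_combination (L Complex.I) * Complex.I_sq
    have hγ1 : ‖γ - 1‖ ≤ ρ := by
      have h1 : L Complex.I - c * Complex.I = c * Complex.I * (γ - 1) := by rw [hLI']; ring
      rw [h1, norm_mul, norm_mul, Complex.norm_I, mul_one, mul_comm] at hLI
      exact le_of_mul_le_mul_right hLI (norm_pos_iff.2 hc)
    have key := norm_sub_le_of_mem_disk hρ0 hρ1 hγ1
    have e1 : dz (extend H c t) a = (c / 2) * (t + γ) := by
      rw [dz, ← hL, hL1, hLI']
      linear_combination (-(1 / 2) * c * γ) * Complex.I_sq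
    have e2 : dzbar (extend H c t) a = (c / 2) * (t - γ) := by
      rw [dzbar, ← hL, hL1, hLI']
      linear_combination ((1 / 2) * c * γ) * Complex.I_sq
    rw [e1, e2, norm_mul, norm_mul, mul_left_comm]
    exact mul_le_mul_of_nonneg_left key (norm_nonneg _)

end Dilatation

/-! ### Boundary values -/

theorem convex_rightHalfPlane : Convex ℝ rightHalfPlane := convex_halfSpace_re_gt 0

theorem isOpen_rightHalfPlane : IsOpen rightHalfPlane :=
  isOpen_lt continuous_const Complex.continuous_re

/-- Both points are shifted right by `s > 0`, which keeps `z - w` fixed, and `s` tends to `0`. -/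
theorem slopesIn_of_forall_pos {H : ℂ → ℂ} {c : ℂ} {ρ : ℝ} (hcont : Continuous H)
    (hH : ∀ z ∈ rightHalfPlane, ∀ w ∈ rightHalfPlane,
      ‖H z - H w - c * (z - w)‖ ≤ ρ * ‖c‖ * ‖z - w‖) : SlopesIn H c ρ := by
  intro z w hz hw
  have hlim : Tendsto (fun s : ℝ => ‖H (z + s) - H (w + s) - c * (z - w)‖) (𝓝[>] 0)
      (𝓝 ‖H z - H w - c * (z - w)‖) := by
    have : Continuous fun s : ℝ => ‖H (z + s) - H (w + s) - c * (z - w)‖ := by fun_prop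
    simpa using (this.tendsto 0).mono_left nhdsWithin_le_nhds
  refine le_of_tendsto hlim ?_
  filter_upwards [self_mem_nhdsWithin] with s hs
  have hs' : 0 < s := hs
  have h1 := hH (z + s) (by change 0 < (z + s).re; simp; linarith)
    (w + s) (by change 0 < (w + s).re; simp; linarith)
  simpa using h1

/-- A holomorphic function on the right half-plane whose derivative lies in a disk extends
continuously to the closed half-plane, with all difference quotients in the disk. -/
theorem exists_slopesIn_extension {h : ℂ → ℂ} (hh : DifferentiableOn ℂ h rightHalfPlane) {c : ℂ}
    {ρ : ℝ} (hρ0 : 0 ≤ ρ) (hderiv : ∀ z ∈ rightHalfPlane, ‖deriv h z - c‖ ≤ ρ * ‖c‖) :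
    ∃ H : ℂ → ℂ, Continuous H ∧ EqOn h H rightHalfPlane ∧ SlopesIn H c ρ := by
  -- Subtracting `c z` centres the derivative disk at `0`, so the mean value inequality gives the
  -- sharp constant.
  have hlip : LipschitzOnWith ⟨ρ * ‖c‖, by positivity⟩ (fun z => h z - c * z) rightHalfPlane := by
    refine convex_rightHalfPlane.lipschitzOnWith_of_nnnorm_deriv_le (𝕜 := ℂ) (fun z hz => ?_)
      fun z hz => ?_
    · exact ((hh.differentiableAt (isOpen_rightHalfPlane.mem_nhds hz)).sub (by fun_prop))
    · have h1 : HasDerivAt (fun z => h z - c * z) (deriv h z - c) z := by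
        have h2 := (hh.differentiableAt (isOpen_rightHalfPlane.mem_nhds hz)).hasDerivAt.sub
          ((hasDerivAt_id z).const_mul c)
        rwa [mul_one] at h2
      rw [h1.deriv]
      exact hderiv z hz
  obtain ⟨g, hg, hgh⟩ := hlip.extend_finite_dimension
  have heq : EqOn h (fun z => g z + c * z) rightHalfPlane := fun z hz => by
    simp [← hgh hz]
  have hcont : Continuous fun z => g z + c * z := hg.continuous.add (by fun_prop)
  refine ⟨_, hcont, heq, slopesIn_of_forall_pos hcont fun z hz w hw => ?_⟩
  have := hlip.dist_le_mul z hz w hw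
  have h1 : h z = g z + c * z := heq hz
  have h2 : h w = g w + c * w := heq hw
  rw [← h1, ← h2]
  rw [dist_eq_norm, dist_eq_norm] at this
  refine le_trans (le_of_eq ?_) this
  congr 1
  ring

theorem tendsto_of_eqOn_rightHalfPlane {h H : ℂ → ℂ} (hH : Continuous H)
    (heq : EqOn h H rightHalfPlane) (z : ℂ) : Tendsto h (𝓝[rightHalfPlane] z) (𝓝 (H z)) :=
  ((hH.tendsto z).mono_left nhdsWithin_le_nhds).congr'
    (heq.symm.eventuallyEq_of_mem self_mem_nhdsWithin)

theorem isGreatest_sqrt_norm_div {c : ℂ} {ρ : ℝ} (hc : c ≠ 0) (hρ0 : 0 ≤ ρ) (hρ1 : ρ < 1)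
    {B : Set ℂ} (hlow : ∀ z ∈ B, ‖c‖ * (1 - ρ) ≤ ‖z‖) (hupp : ∀ z ∈ B, ‖z‖ ≤ ‖c‖ * (1 + ρ))
    (h1 : c * (1 + ρ : ℝ) ∈ B) (h2 : c * (1 - ρ : ℝ) ∈ B) :
    IsGreatest {x : ℝ | ∃ w ∈ B, ∃ z ∈ B, x = √‖w / z‖} √((1 + ρ) / (1 - ρ)) := by
  have hc' := norm_pos_iff.2 hc
  have hρ' : 0 < 1 - ρ := by linarith
  refine ⟨⟨_, h1, _, h2, ?_⟩, ?_⟩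
  · rw [mul_div_mul_left _ _ hc, norm_div, Complex.norm_real, Complex.norm_real,
      Real.norm_of_nonneg (by linarith), Real.norm_of_nonneg hρ'.le]
  · rintro x ⟨w, hw, z, hz, rfl⟩
    refine Real.sqrt_le_sqrt ?_
    rw [norm_div, ← mul_div_mul_left (1 + ρ) (1 - ρ) hc'.ne']
    exact div_le_div₀ (by nlinarith) (hupp w hw) (mul_pos hc' hρ') (hlow z hz)

end QCExt

end

/-! ### Assembly of the theorem -/

theorem mainTheorem6 (h : ℂ → ℂ) (hh : DifferentiableOn ℂ h QCExt.rightHalfPlane)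
    (B : Set ℂ) (hB : ∃ (c : ℂ) (r : ℝ), B = Metric.closedBall c r) (h0 : (0 : ℂ) ∉ B)
    (hderiv : ∀ z ∈ QCExt.rightHalfPlane, deriv h z ∈ B) :
    ∃ K : ℝ, IsGreatest {x : ℝ | ∃ w ∈ B, ∃ z ∈ B, x = √‖w / z‖} K ∧
    ∃ w₁ ∈ B, ∃ w₂ ∈ B, (∀ w ∈ B, ‖w‖ ≤ ‖w₁‖) ∧ (∀ w ∈ B, ‖w₂‖ ≤ ‖w‖) ∧
    ∃ ω ∈ B, ω ^ 2 = w₁ * w₂ ∧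
    ∃ f : OnePoint ℂ ≃ₜ OnePoint ℂ,
      QCExt.IsSphereQuasiconformal ((K - 1) / (K + 1)) f ∧
      f ∞ = ∞ ∧
      (∀ z ∈ QCExt.rightHalfPlane, f (z : OnePoint ℂ) = (h z : OnePoint ℂ)) ∧
      ∃ b : ℝ → ℂ,
        (∀ y : ℝ, Tendsto h (𝓝[QCExt.rightHalfPlane] ((y : ℂ) * Complex.I)) (𝓝 (b y))) ∧
        ∀ x y : ℝ, x ≤ 0 →
          f (((x : ℂ) + (y : ℂ) * Complex.I : ℂ) : OnePoint ℂ) =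
            ((b y + ω * (x : ℂ) : ℂ) : OnePoint ℂ) := by
  obtain ⟨c, r, rfl⟩ := hB
  -- The ball contains `deriv h 1`, so its radius is not negative.
  have hr0 : 0 ≤ r := Metric.nonempty_closedBall.1 ⟨_, hderiv 1 (by simp [QCExt.rightHalfPlane])⟩
  have hrc : r < ‖c‖ := by simpa using h0
  have hcpos : 0 < ‖c‖ := hr0.trans_lt hrc
  have hc : c ≠ 0 := norm_pos_iff.1 hcpos
  obtain ⟨ρ, hρ⟩ : ∃ ρ, ρ = r / ‖c‖ := ⟨_, rfl⟩
  have hρ0 : 0 ≤ ρ := hρ ▸ div_nonneg hr0 hcpos.le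
  have hρ1 : ρ < 1 := by rw [hρ, div_lt_one hcpos]; exact hrc
  have hr : r = ρ * ‖c‖ := by rw [hρ, div_mul_cancel₀ _ hcpos.ne']
  have hmem : ∀ s : ℝ, |s - 1| ≤ ρ → c * s ∈ Metric.closedBall c r := fun s hs => by
    have : c * s - c = c * ((s - 1 : ℝ) : ℂ) := by push_cast; ring
    rw [Metric.mem_closedBall, dist_eq_norm, this, norm_mul, Complex.norm_real, Real.norm_eq_abs,
      hr, mul_comm]
    exact mul_le_mul_of_nonneg_right hs hcpos.le
  have hupp : ∀ w ∈ Metric.closedBall c r, ‖w‖ ≤ ‖c‖ * (1 + ρ) := fun w hw => by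
    rw [Metric.mem_closedBall, dist_eq_norm, hr] at hw
    linarith [norm_sub_norm_le w c]
  have hlow : ∀ w ∈ Metric.closedBall c r, ‖c‖ * (1 - ρ) ≤ ‖w‖ := fun w hw => by
    rw [Metric.mem_closedBall, dist_eq_norm, norm_sub_rev, hr] at hw
    linarith [norm_sub_norm_le c w]
  have hw1 : c * (1 + ρ : ℝ) ∈ Metric.closedBall c r := hmem _ (by simp [abs_of_nonneg hρ0])
  have hw2 : c * (1 - ρ : ℝ) ∈ Metric.closedBall c r := hmem _ (by simp [abs_of_nonneg hρ0])
  have hsq : √(1 - ρ ^ 2) ^ 2 = 1 - ρ ^ 2 := Real.sq_sqrt (by nlinarith)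
  have ht0 : 0 < √(1 - ρ ^ 2) := Real.sqrt_pos.2 (by nlinarith)
  have ht1 : √(1 - ρ ^ 2) ≤ 1 := Real.sqrt_le_one.2 (by nlinarith)
  -- Together with `ht1` this places `ω = c t` in the disk, selecting the right square root of `w₁
  -- w₂ = c² (1 - ρ²)`.
  have htρ : 1 - ρ ≤ √(1 - ρ ^ 2) := Real.le_sqrt_of_sq_le (by nlinarith)
  have hK1 := QCExt.one_le_sqrt_div hρ0 hρ1
  obtain ⟨H, hHc, heq, hH⟩ := QCExt.exists_slopesIn_extension hh (c := c) hρ0 fun z hz => by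
    rw [← hr, ← dist_eq_norm]
    exact hderiv z hz
  obtain ⟨F, hF⟩ := QCExt.exists_homeo_extend hH hc hρ0 hρ1 ht0
  have hHd : DifferentiableOn ℂ H QCExt.rightHalfPlane := hh.congr fun z hz => (heq hz).symm
  refine ⟨_, QCExt.isGreatest_sqrt_norm_div hc hρ0 hρ1 hlow hupp hw1 hw2,
    _, hw1, _, hw2, fun w hw => ?_, fun w hw => ?_, c * √(1 - ρ ^ 2),
    hmem _ (abs_le.2 ⟨by linarith, by linarith⟩), ?_, F.onePointCongr, ?_, rfl, fun z hz => ?_,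
    fun y => H (y * Complex.I), fun y => QCExt.tendsto_of_eqOn_rightHalfPlane hHc heq _,
    fun x y hx => ?_⟩
  · rw [norm_mul, Complex.norm_real, Real.norm_of_nonneg (by linarith)]
    exact hupp w hw
  · rw [norm_mul, Complex.norm_real, Real.norm_of_nonneg (by linarith)]
    exact hlow w hw
  · rw [mul_pow, ← Complex.ofReal_pow, hsq]
    push_cast
    ring
  · refine QCExt.isSphereQuasiconformal_onePointCongr (L := (1 + ρ) * ‖c‖)
      (m := (1 - ρ) * ‖c‖ * √(1 - ρ ^ 2)) (div_nonneg (by linarith) (by linarith))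
      ((div_lt_one (by linarith)).2 (by linarith))
      (mul_pos (mul_pos (by linarith) hcpos) ht0) ?_ ?_ ?_ ?_
    all_goals simp only [hF, funext hF]
    · exact QCExt.norm_extend_sub_le_mul hH hρ0 ht0 ht1
    · exact QCExt.le_norm_extend_sub hH hρ0 hρ1 ht0 ht1
    · exact QCExt.exists_log_extend_sub_div hH hc hρ0 hρ1 ht0 ht1
    · exact QCExt.dilatationLE_extend hρ0 hρ1 hH hc hHd
  · have hz' : 0 ≤ z.re := le_of_lt hz
    have e : QCExt.fold 0 z = z := by apply Complex.ext <;> simp [QCExt.fold, hz']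
    change ((F z : ℂ) : OnePoint ℂ) = _
    rw [hF, QCExt.extend, e, min_eq_right hz', heq hz]
    simp
  · have e : QCExt.fold 0 (x + y * Complex.I) = y * Complex.I := by
      apply Complex.ext <;> simp [QCExt.fold, hx]
    change ((F (x + y * Complex.I) : ℂ) : OnePoint ℂ) = _
    rw [hF, QCExt.extend, e]
    simp [hx]
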